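/- A decision problem is *decided in time $O(f)$* if there are a (deterministic) word-RAM program and a constant $c$ such that, on inputs of $N$ words and with any word size of at least $c\log_2(N+2)$ bits, the program decides every instance of size $n$ correctly within $O(f(n))$ steps. *Orthogonal Vectors Conjecture (OVC).* Given $n\ge 1$ vectors $a_1,\dots,a_n$ and $n$ vectors $b_1,\dots,b_n$ in $\{0,1\}^d$, where $d=d(n)$, decide whether $\sum_k a_{i,k}b_{j,k}=0$ for some $i,j$. OVC states that for every $d(n)=\omega(\log n)$ and every $\varepsilon>0$ this problem cannot be decided in time $O(n^{2-\varepsilon})$. *Barking distance.* For polylines $P,Q$ in the Euclidean plane, of lengths $|P|,|Q|$ and parametrized by arc length as $P[\cdot],Q[\cdot]$, a barking radius $\rho$ and a maximum speed $s$ of the dog (the hiker has speed $1$), let $$\mathcal D^s_\rho(P,Q)=\inf_\gamma \lambda\big(\{t\in[0,|P|] : \|P[t]-Q[\gamma(t)]\|>\rho\}\big),$$ where $\lambda$ is Lebesgue measure and $\gamma$ ranges over the $s$-Lipschitz (not necessarily monotone) functions $\gamma:[0,|P|]\to[0,|Q|]$ with $\gamma(0)=0$ and $\gamma(|P|)=|Q|$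 (the infimum is $\infty$ if there is none). **Theorem.** Assume OVC. Then for every constant $\rho>0$ there is a constant $\kappa$ such that for every $\varepsilon>0$ the following problem cannot be decided in time $O(n^{2-\varepsilon})$: given two disjoint simple polylines $P$ and $Q$ in the plane with $n\ge 2$ vertices each, whose coordinates are rationals (given as fractions) with numerators and denominators at most $n^{\kappa}$ in absolute value, decide whether $\mathcal D^1_\rho(P,Q)=0$; that is, whether the barking distance with radius $\rho$ is zero when the maximum speed of the dog equals the speed of the hiker. -/

import Mathlib

open scoped ENNReal NNReal

/-! ### The word RAM

Words are natural numbers below `2 ^ w`. A program uses finitely many registers and finitely many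
word-indexed arrays, and every elementary instruction and every test takes one time step. -/

namespace WordRAM

/-- The unit-cost operations on words. -/
inductive BinOp where
  | add | sub | mul | div | mod | and | or | xor | shl | shr | eq | lt

/-- Semantics of the operations on `w`-bit words (arithmetic is modulo `2 ^ w`). -/
def BinOp.eval (w : ℕ) : BinOp → ℕ → ℕ → ℕ
  | .add, a, b => (a + b) % 2 ^ w
  | .sub, a, b => (a + (2 ^ w - b % 2 ^ w)) % 2 ^ w
  | .mul, a, b => (a * b) % 2 ^ w
  | .div, a, b => a / b
  | .mod, a, b => a % b
  | .and, a, b => a &&& b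
  | .or, a, b => a ||| b
  | .xor, a, b => a ^^^ b
  | .shl, a, b => (a * 2 ^ b) % 2 ^ w
  | .shr, a, b => a / 2 ^ b
  | .eq, a, b => if a = b then 1 else 0
  | .lt, a, b => if a < b then 1 else 0

/-- Programs. Registers and arrays are named by numerals that are fixed in the program text;
positions inside an array are computed at run time. -/
inductive Prog where
  /-- register `r` := the constant `k` -/
  | const (r k : ℕ)
  /-- register `r` := `o` applied to registers `a` and `b` -/
  | op (o : BinOp) (r a b : ℕ)
  /-- register `r` := the entry of array `m` at the position in register `a` -/
  | load (r m a : ℕ)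
  /-- the entry of array `m` at the position in register `a` := register `b` -/
  | store (m a b : ℕ)
  /-- `p`, then `q` -/
  | seq (p q : Prog)
  /-- if register `a` is nonzero then `p` else `q` -/
  | branch (a : ℕ) (p q : Prog)
  /-- while register `a` is nonzero do `p` -/
  | loop (a : ℕ) (p : Prog)

/-- Contents of the registers and of the arrays. -/
structure State where
  reg : ℕ → ℕ
  mem : ℕ → ℕ → ℕ

/-- Write the value `v` to register `r`. -/
def State.setReg (s : State) (r v : ℕ) : State :=
  { s with reg := Function.update s.reg r v }

/-- Write the value `v` to position `i` of array `m`. -/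
def State.setMem (s : State) (m i v : ℕ) : State :=
  { s with mem := Function.update s.mem m (Function.update (s.mem m) i v) }

/-- `Run w p s t s'`: with word size `w`, the program `p` started in state `s` halts in state `s'`
after exactly `t` time steps. -/
inductive Run (w : ℕ) : Prog → State → ℕ → State → Prop
  | const (r k : ℕ) (s : State) : Run w (.const r k) s 1 (s.setReg r (k % 2 ^ w))
  | op (o : BinOp) (r a b : ℕ) (s : State) :
      Run w (.op o r a b) s 1 (s.setReg r (o.eval w (s.reg a) (s.reg b)))
  | load (r m a : ℕ) (s : State) :
      Run w (.load r m a) s 1 (s.setReg r (s.mem m (s.reg a)))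
  | store (m a b : ℕ) (s : State) :
      Run w (.store m a b) s 1 (s.setMem m (s.reg a) (s.reg b))
  | seq {p q : Prog} {s s' s'' : State} {t t' : ℕ} :
      Run w p s t s' → Run w q s' t' s'' → Run w (.seq p q) s (t + t') s''
  | branch_true {a : ℕ} {p q : Prog} {s s' : State} {t : ℕ} :
      s.reg a ≠ 0 → Run w p s t s' → Run w (.branch a p q) s (t + 1) s'
  | branch_false {a : ℕ} {p q : Prog} {s s' : State} {t : ℕ} :
      s.reg a = 0 → Run w q s t s' → Run w (.branch a p q) s (t + 1) s'
  | loop_done {a : ℕ} {p : Prog} {s : State} : s.reg a = 0 → Run w (.loop a p) s 1 s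
  | loop_step {a : ℕ} {p : Prog} {s s' s'' : State} {t t' : ℕ} :
      s.reg a ≠ 0 → Run w p s t s' → Run w (.loop a p) s' t' s'' →
      Run w (.loop a p) s (t + t' + 1) s''

/-- The initial state on input `x`: array `0` starts with `x`, everything else is zero. -/
def init (x : List ℕ) : State where
  reg := fun _ => 0
  mem := fun m i => if m = 0 then x.getD i 0 else 0

end WordRAM

/-- A decision problem: its instances, the size parameter in which running times are measured, the
list of words by which an instance is given to a machine, and the set of yes-instances. -/
structure DecisionProblem where
  Inst : Type
  size : Inst → ℕ
  words : Inst → List ℕ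
  Yes : Inst → Prop

/-- The problem `Pb` is decided in time `O(f(size))` on the word RAM with words of `O(log N)` bits, `N` the
length of the input: there are one program `p` and constants `c`, `C` such that with every word
size of at least `c * log₂ (N + 2)` bits, `p` halts within `C * f(size)` steps, with `1` in register
`0` exactly on the yes-instances. -/
def DecisionProblem.SolvableInTime (Pb : DecisionProblem) (f : ℕ → ℝ) : Prop :=
  ∃ (p : WordRAM.Prog) (c : ℕ) (C : ℝ), ∀ (I : Pb.Inst) (w : ℕ),
    ((Pb.words I).length + 2) ^ c ≤ 2 ^ w →
      ∃ (t : ℕ) (s : WordRAM.State), WordRAM.Run w p (WordRAM.init (Pb.words I)) t s ∧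
        (t : ℝ) ≤ C * f (Pb.size I) ∧ (s.reg 0 = 1 ↔ Pb.Yes I)

/-! ### Orthogonal vectors -/

/-- Two families of `n ≥ 1` vectors each in `{0,1}^d`, with `d = d(n)`. -/
structure OVInstance (d : ℕ → ℕ) where
  n : ℕ
  one_le : 1 ≤ n
  A : Fin n → Fin (d n) → Bool
  B : Fin n → Fin (d n) → Bool

/-- The entries of a 0-1 matrix, row by row. -/
def bitWords {n d : ℕ} (A : Fin n → Fin d → Bool) : List ℕ :=
  (List.ofFn fun i => List.ofFn fun j => (A i j).toNat).flatten

/-- The orthogonal vectors problem in dimension `d = d(n)`. -/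
def orthogonalVectors (d : ℕ → ℕ) : DecisionProblem where
  Inst := OVInstance d
  size := fun I => I.n
  words := fun I => I.n :: d I.n :: (bitWords I.A ++ bitWords I.B)
  Yes := fun I => ∃ i j, ∑ k, (I.A i k).toNat * (I.B j k).toNat = 0

/-- The Orthogonal Vectors Conjecture: in dimension `d = ω(log n)`, orthogonal vectors cannot be
decided in time `O(n ^ (2 - ε))`, for any `ε > 0`. -/
def OrthogonalVectorsConjecture : Prop :=
  ∀ d : ℕ → ℕ, (fun n : ℕ => Real.log n) =o[Filter.atTop] (fun n : ℕ => (d n : ℝ)) →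
    ∀ ε : ℝ, 0 < ε →
      ¬ (orthogonalVectors d).SolvableInTime fun n => (n : ℝ) ^ (2 - ε)

/-! ### Polylines and the barking distance -/

/-- The Euclidean plane. -/
abbrev Plane : Type := EuclideanSpace ℝ (Fin 2)

namespace Polyline

/-- The Euclidean length of a polyline. -/
noncomputable def length : List Plane → ℝ
  | [] => 0
  | [_] => 0
  | p :: q :: l => dist p q + length (q :: l)

/-- The traversal of a polyline at unit speed: `point l t` is the point of `l` at distance `t` from
the first vertex along `l`, for `0 ≤ t ≤ length l`. -/
noncomputable def point : List Plane → ℝ → Plane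
  | [], _ => 0
  | [p], _ => p
  | p :: q :: l, t =>
      if t ≤ dist p q then AffineMap.lineMap p q (t / dist p q)
      else point (q :: l) (t - dist p q)

/-- The set of points on a polyline. -/
def carrier (l : List Plane) : Set Plane := point l '' Set.Icc 0 (length l)

/-- A simple polyline: no repeated vertices and no self-intersections. -/
def IsSimple (l : List Plane) : Prop :=
  l.Nodup ∧ Set.InjOn (point l) (Set.Icc 0 (length l))

/-- A walk `γ` of the dog along `Q` while the hiker traverses `P` at unit speed: it leads from the
start to the end of `Q`, forwards and backwards, with speed at most `s`. -/
structure IsWalk (s : ℝ≥0) (P Q : List Plane) (γ : ℝ → ℝ) : Prop where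
  mapsTo : Set.MapsTo γ (Set.Icc 0 (length P)) (Set.Icc 0 (length Q))
  start : γ 0 = 0
  finish : γ (length P) = length Q
  speed : LipschitzOnWith s γ (Set.Icc 0 (length P))

/-- The threshold function: `1` if the points are more than `ρ` apart, else `0`. -/
noncomputable def threshold (ρ : ℝ) (p q : Plane) : ℝ≥0∞ :=
  if ρ < dist p q then 1 else 0

/-- The (continuous) barking distance from `P` to `Q`: the least time that the hiker on `P` spends
out of the barking radius `ρ` of a dog on `Q` of maximum speed `s` (`∞` if the dog has no walk). -/
noncomputable def barkingDistance (ρ : ℝ) (s : ℝ≥0) (P Q : List Plane) : ℝ≥0∞ :=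
  ⨅ (γ : ℝ → ℝ) (_ : IsWalk s P Q γ),
    ∫⁻ t in Set.Icc 0 (length P), threshold ρ (point P t) (point Q (γ t))

end Polyline

/-! ### The barking decision problem -/

/-- A point with rational coordinates `x / den` and `y / den` (not necessarily in lowest terms). -/
structure RatPoint where
  x : ℤ
  y : ℤ
  den : ℕ
  den_pos : 0 < den

/-- The point of the plane. -/
noncomputable def RatPoint.toPlane (v : RatPoint) : Plane :=
  !₂[(v.x : ℝ) / v.den, (v.y : ℝ) / v.den]

/-- Five words for a point: sign and absolute value of the numerators, and the denominator. -/
def RatPoint.words (v : RatPoint) : List ℕ :=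
  [if v.x < 0 then 1 else 0, v.x.natAbs, if v.y < 0 then 1 else 0, v.y.natAbs, v.den]

/-- All numerators and denominators are at most `b`. -/
def RatPoint.BoundedBy (v : RatPoint) (b : ℕ) : Prop :=
  v.x.natAbs ≤ b ∧ v.y.natAbs ≤ b ∧ v.den ≤ b

/-- The polyline in the plane with the given vertices. -/
noncomputable def ratPolyline {n : ℕ} (P : Fin n → RatPoint) : List Plane :=
  List.ofFn fun i => (P i).toPlane

/-- Two disjoint simple polylines with `n ≥ 2` vertices each, whose coordinates are rationals with
numerators and denominators at most `n ^ κ`. -/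
structure BarkingInstance (κ : ℕ) where
  n : ℕ
  two_le : 2 ≤ n
  P : Fin n → RatPoint
  Q : Fin n → RatPoint
  bounded_P : ∀ i, (P i).BoundedBy (n ^ κ)
  bounded_Q : ∀ i, (Q i).BoundedBy (n ^ κ)
  simple_P : Polyline.IsSimple (ratPolyline P)
  simple_Q : Polyline.IsSimple (ratPolyline Q)
  disjoint : Disjoint (Polyline.carrier (ratPolyline P)) (Polyline.carrier (ratPolyline Q))

/-- The barking decision problem with fixed barking radius `ρ`, for a dog whose maximum speed is the
speed of the hiker: is the barking distance zero? -/
noncomputable def barkingDecision (ρ : ℝ) (κ : ℕ) : DecisionProblem where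
  Inst := BarkingInstance κ
  size := fun I => I.n
  words := fun I => I.n ::
    ((List.ofFn fun i => (I.P i).words).flatten ++ (List.ofFn fun i => (I.Q i).words).flatten)
  Yes := fun I => Polyline.barkingDistance ρ 1 (ratPolyline I.P) (ratPolyline I.Q) = 0

/-! ### The two sequences of levels -/

/-! Reduction from orthogonal vectors, with `M = n * (4 * d + 20)`. Both polylines zigzag
horizontally between integer levels, in units of `u = a / b`, while drifting slowly up (hiker) or
down (dog), which makes them simple and disjoint. The dog's line is shifted by three units, so the
dog is in range when dog level ≤ hiker level ≤ dog level + 6 (`InRange`). It has `M` unit steps,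
each cut into four edges; the hiker has `4 * M` unit steps.

The dog's line has one block per vector `b_j`: level 0, a gadget encoding `b_j`, a valley of level
1, a peak of level 5, and a buffer. The hiker first alternates between levels 5 and 6, where every
dog position is in range, so the dog may walk to any block. At level 0 he forces the dog to the
start of some block. Then he passes the gadgets of all `a_i`, at levels 1 to 4, so that the dog
cannot cross a peak. Between gadgets his level 1 forces the dog into a valley. Finally he climbs to
level 11, which only a dog on a peak survives, so within ten steps the dog must reach a peak. This
is possible from the valley behind a gadget but not from the start of a block. Hence the dog crosses
some gadget `b_j` during some gadget `a_i`. There is just enough time for this at full speed, so the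
two profiles are traversed in step, and staying in range means that no coordinate is 1 in both
vectors (`orthogonal_of_walk`). Conversely an orthogonal pair yields the walk `dogWalk`, and at the
end the hiker returns to levels 5 and 6 while the dog finishes.

Continuous walks become discrete by rounding to positions of the right parity: levels change by one
per step, so parity absorbs the rounding error (`exists_discrete_walk`). Choosing `13/4 * u ≤ ρ <
7/2 * u` leaves room for the vertical drift on one side and for an almost optimal walk on the other
(`barkingDistance_of_hasOrthogonalPair`, `hasOrthogonalPair_of_barkingDistance`).

The reduction is a word-RAM program writing `O(n * d)` words in as many steps (`reaches_reduction`);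
an assumed fast decision program then runs on its output in fresh registers and arrays
(`Run.shift`). With `d` about `n ^ δ` for small `δ`, a subquadratic algorithm for barking distance
yields one for orthogonal vectors, against OVC. -/

namespace BarkingReduction

/-- The profile of one coordinate: four unit steps, forming one tall or two short waves. -/
def wave (r : ℕ) (tall : Bool) : ℕ := if r = 2 then 2 * tall.toNat else r % 2

/-- Collects linear facts about `wave`, so that later claims about levels are case splits closed by
`omega`. -/
theorem wave_spec (r : ℕ) (t : Bool) :
    (r % 2 = 1 → wave r t = 1) ∧ (r % 2 = 0 → r ≤ 3 → wave r t = 0 ∨ wave r t = 2) ∧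
      (r = 0 → wave r t = 0) := by
  unfold wave
  cases t <;> simp only [Bool.toNat_false, Bool.toNat_true] <;> refine ⟨?_, ?_, ?_⟩ <;> intros <;>
    split_ifs <;> omega

/-- The profile of a vector gadget on the hiker's polyline. -/
def hikerGadget (row : ℕ → Bool) (o : ℕ) : ℕ :=
  if o = 0 then 0 else 1 + wave ((o - 1) % 4) (!row ((o - 1) / 4))

/-- The time at which the hiker has passed all vector gadgets. -/
def climbTime (n d : ℕ) : ℕ := n * (4 * d + 20) + 6 + n * (4 * d + 2)

/-- The level of the hiker at time `k`. -/
def hikerLevel (n d : ℕ) (α : ℕ → ℕ → Bool) (k : ℕ) : ℕ :=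
  -- Levels 5 and 6 leave the dog free for `M` steps, enough to reach any block.
  if k ≤ n * (4 * d + 20) then 5 + k % 2
  else if k ≤ n * (4 * d + 20) + 5 then n * (4 * d + 20) + 5 - k
  else if k ≤ climbTime n d then
    1 + hikerGadget (α ((k - (n * (4 * d + 20) + 6)) / (4 * d + 2)))
      ((k - (n * (4 * d + 20) + 6)) % (4 * d + 2))
  else if k ≤ climbTime n d + 10 then 1 + (k - climbTime n d)
  else if k ≤ climbTime n d + 16 then climbTime n d + 21 - k
  else 5 + k % 2

/-- The profile of a vector gadget on the dog's polyline, with the barrier that follows it. -/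
def dogBlock (d : ℕ) (row : ℕ → Bool) (o : ℕ) : ℕ :=
  if o ≤ 1 then o
  else if o ≤ 4 * d + 2 then 2 + wave ((o - 2) % 4) (row ((o - 2) / 4))
  else if o ≤ 4 * d + 3 then 1
  else if o ≤ 4 * d + 7 then o - (4 * d + 2)
  else if o ≤ 4 * d + 10 then 4 * d + 12 - o
  -- This buffer puts the peak at `4 * d + 7` thirteen positions before the next block start, too
  -- far for the ten steps of the hiker's climb.
  else if o ≤ 4 * d + 18 then 2 + o % 2
  else 1

/-- The level of the dog's polyline at distance `m` from its start. -/
def dogLevel (d : ℕ) (β : ℕ → ℕ → Bool) (m : ℕ) : ℕ :=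
  dogBlock d (β (m / (4 * d + 20))) (m % (4 * d + 20))

theorem dogLevel_block (d : ℕ) (β : ℕ → ℕ → Bool) (j o : ℕ) (ho : o < 4 * d + 20) :
    dogLevel d β (j * (4 * d + 20) + o) = dogBlock d (β j) o := by
  unfold dogLevel
  rw [mul_comm j, Nat.mul_add_div (by omega), Nat.mul_add_mod, Nat.mod_eq_of_lt ho,
    Nat.div_eq_of_lt ho, add_zero]

theorem exists_block (d m : ℕ) : ∃ j o, o < 4 * d + 20 ∧ m = j * (4 * d + 20) + o :=
  ⟨m / (4 * d + 20), m % (4 * d + 20), Nat.mod_lt _ (by omega), (Nat.div_add_mod' _ _).symm⟩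

/-- The last offset is exempt because its successor is offset 0 of the next block; `dogLevel_step`
treats that transition. -/
theorem dogBlock_step (d : ℕ) (row : ℕ → Bool) (o : ℕ) :
    dogBlock d row (o + 1) = dogBlock d row o + 1 ∨
      dogBlock d row o = dogBlock d row (o + 1) + 1 ∨ 4 * d + 19 ≤ o := by
  have h1 := wave_spec ((o - 2) % 4) (row ((o - 2) / 4))
  have h2 := wave_spec ((o + 1 - 2) % 4) (row ((o + 1 - 2) / 4))
  unfold dogBlock
  split_ifs <;> omega

theorem dogLevel_step (d : ℕ) (β : ℕ → ℕ → Bool) (m : ℕ) :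
    dogLevel d β (m + 1) = dogLevel d β m + 1 ∨ dogLevel d β m = dogLevel d β (m + 1) + 1 := by
  obtain ⟨j, o, ho, rfl⟩ := exists_block d m
  rcases Nat.lt_or_ge (o + 1) (4 * d + 20) with h | h
  · rw [add_assoc, dogLevel_block _ _ _ _ h, dogLevel_block _ _ _ _ ho]
    have := dogBlock_step d (β j) o
    omega
  · have ho' : o = 4 * d + 19 := by omega
    subst ho'
    have e : j * (4 * d + 20) + (4 * d + 19) + 1 = (j + 1) * (4 * d + 20) + 0 := by ring
    rw [e, dogLevel_block _ _ _ _ (by omega), dogLevel_block _ _ _ _ ho]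
    right
    unfold dogBlock
    split_ifs <;> omega

/-- Together with `hikerLevel_parity` this fixes the parity of the level difference once the dog's
position has the parity of `k + 1`; rounding relies on it. -/
theorem dogLevel_parity (d : ℕ) (β : ℕ → ℕ → Bool) (m : ℕ) : dogLevel d β m % 2 = m % 2 := by
  induction m with
  | zero =>
    have := dogLevel_block d β 0 0 (by omega)
    simp only [zero_mul, add_zero] at this
    simp [this, dogBlock]
  | succ m ih => have := dogLevel_step d β m; omega

/-- Since dog levels lie between 0 and 5, a hiker at level 5 or 6 is in range of the whole dog's
line. -/
theorem dogLevel_le (d : ℕ) (β : ℕ → ℕ → Bool) (m : ℕ) : dogLevel d β m ≤ 5 := by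
  obtain ⟨j, o, ho, rfl⟩ := exists_block d m
  rw [dogLevel_block _ _ _ _ ho]
  have h1 := wave_spec ((o - 2) % 4) (β j ((o - 2) / 4))
  unfold dogBlock
  split_ifs <;> omega

/-- The clause for `o % 4 = 1` covers `o = 4 * d + 1`, where the profile consults column `d` outside
the matrix: the wave starts at 0 whatever that bit is. -/
theorem hikerGadget_spec (row : ℕ → Bool) (o : ℕ) :
    hikerGadget row o % 2 = o % 2 ∧ hikerGadget row o ≤ 3 ∧
      (o % 4 = 1 → hikerGadget row o = 1) ∧ (o = 0 → hikerGadget row o = 0) ∧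
      (o ≠ 0 → 1 ≤ hikerGadget row o) := by
  have h := wave_spec ((o - 1) % 4) (!row ((o - 1) / 4))
  unfold hikerGadget
  refine ⟨?_, ?_, ?_, ?_, ?_⟩ <;> intros <;> split_ifs <;> omega

theorem hikerGadget_step (row : ℕ → Bool) (o : ℕ) :
    hikerGadget row (o + 1) = hikerGadget row o + 1 ∨
      hikerGadget row o = hikerGadget row (o + 1) + 1 := by
  have h1 := wave_spec ((o - 1) % 4) (!row ((o - 1) / 4))
  have h2 := wave_spec ((o + 1 - 1) % 4) (!row ((o + 1 - 1) / 4))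
  unfold hikerGadget
  split_ifs <;> first | contradiction | omega

section hiker

variable (n d : ℕ) (α : ℕ → ℕ → Bool)

theorem hikerLevel_early {k : ℕ} (h : k ≤ n * (4 * d + 20)) :
    hikerLevel n d α k = 5 + k % 2 := by simp [hikerLevel, h]

theorem hikerLevel_descent {k : ℕ} (h : k ≤ 5) :
    hikerLevel n d α (n * (4 * d + 20) + k) = 5 - k := by
  unfold hikerLevel
  -- Adjacent phases share an endpoint; at `k = 0` the first branch gives 5 because `M` is even.
  have : n * (4 * d + 20) % 2 = 0 := by
    rw [show n * (4 * d + 20) = 2 * (n * (2 * d + 10)) by ring]; simp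
  split_ifs <;> omega

theorem hikerLevel_gadget {i o : ℕ} (hi : i < n) (ho : o ≤ 4 * d + 2) :
    hikerLevel n d α (n * (4 * d + 20) + 6 + i * (4 * d + 2) + o) =
      1 + if o = 4 * d + 2 then 0 else hikerGadget (α i) o := by
  have h1 : (i + 1) * (4 * d + 2) ≤ n * (4 * d + 2) := Nat.mul_le_mul_right _ hi
  rw [add_mul, one_mul] at h1
  unfold hikerLevel climbTime
  have e : n * (4 * d + 20) + 6 + i * (4 * d + 2) + o - (n * (4 * d + 20) + 6) =
    (4 * d + 2) * i + o := by rw [mul_comm _ i]; omega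
  rw [if_neg (by omega), if_neg (by omega), if_pos (by omega), e, Nat.mul_add_div (by omega),
    Nat.mul_add_mod]
  split_ifs with h
  · subst h; simp [hikerGadget]
  · have ho' : o < 4 * d + 2 := by omega
    rw [Nat.mod_eq_of_lt ho', Nat.div_eq_of_lt ho', add_zero]

theorem hikerLevel_climb {k : ℕ} (h : k ≤ 10) :
    hikerLevel n d α (climbTime n d + k) = 1 + k := by
  rcases Nat.eq_zero_or_pos k with rfl | hk
  · unfold hikerLevel climbTime
    rw [if_neg (by omega), if_neg (by omega), if_pos (by omega)]
    have e : n * (4 * d + 20) + 6 + n * (4 * d + 2) + 0 - (n * (4 * d + 20) + 6) =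
      n * (4 * d + 2) := by omega
    rw [e, Nat.mul_mod_left]; simp [hikerGadget]
  · unfold hikerLevel
    have : climbTime n d = n * (4 * d + 20) + 6 + n * (4 * d + 2) := rfl
    rw [if_neg (by omega), if_neg (by omega), if_neg (by omega), if_pos (by omega)]
    omega

theorem climbTime_even : climbTime n d % 2 = 0 := by
  unfold climbTime
  rw [show n * (4 * d + 20) + 6 + n * (4 * d + 2) = 2 * (n * (2 * d + 10) + 3 + n * (2 * d + 1))
    by ring]; simp

theorem hikerLevel_return {k : ℕ} (h : k ≤ 6) :
    hikerLevel n d α (climbTime n d + 10 + k) = 11 - k := by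
  rcases Nat.eq_zero_or_pos k with rfl | hk
  · exact hikerLevel_climb n d α (k := 10) le_rfl
  · unfold hikerLevel
    have : climbTime n d = n * (4 * d + 20) + 6 + n * (4 * d + 2) := rfl
    rw [if_neg (by omega), if_neg (by omega), if_neg (by omega), if_neg (by omega),
      if_pos (by omega)]
    omega

theorem hikerLevel_late (k : ℕ) :
    hikerLevel n d α (climbTime n d + 16 + k) = 5 + k % 2 := by
  rcases Nat.eq_zero_or_pos k with rfl | hk
  · exact hikerLevel_return n d α (k := 6) le_rfl
  · unfold hikerLevel
    have : climbTime n d = n * (4 * d + 20) + 6 + n * (4 * d + 2) := rfl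
    have := climbTime_even n d
    rw [if_neg (by omega), if_neg (by omega), if_neg (by omega), if_neg (by omega),
      if_neg (by omega)]
    omega

/-- Every time falls into one of the phases of the hiker's motion. -/
theorem time_cases (k : ℕ) :
    k ≤ n * (4 * d + 20) ∨ (∃ e, e ≤ 5 ∧ k = n * (4 * d + 20) + e) ∨
      (∃ i o, i < n ∧ o < 4 * d + 2 ∧ k = n * (4 * d + 20) + 6 + i * (4 * d + 2) + o) ∨
      (∃ e, e ≤ 10 ∧ k = climbTime n d + e) ∨
      (∃ e, e ≤ 6 ∧ k = climbTime n d + 10 + e) ∨ ∃ e, k = climbTime n d + 16 + e := by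
  by_cases h1 : k ≤ n * (4 * d + 20)
  · exact Or.inl h1
  by_cases h2 : k ≤ n * (4 * d + 20) + 5
  · exact Or.inr (Or.inl ⟨k - n * (4 * d + 20), by omega, by omega⟩)
  have hc : climbTime n d = n * (4 * d + 20) + 6 + n * (4 * d + 2) := rfl
  by_cases h3 : k < climbTime n d
  · refine Or.inr (Or.inr (Or.inl ⟨(k - (n * (4 * d + 20) + 6)) / (4 * d + 2),
      (k - (n * (4 * d + 20) + 6)) % (4 * d + 2), ?_, Nat.mod_lt _ (by omega), ?_⟩))
    · rw [Nat.div_lt_iff_lt_mul (by omega)]; omega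
    · have := Nat.div_add_mod' (k - (n * (4 * d + 20) + 6)) (4 * d + 2)
      omega
  by_cases h4 : k ≤ climbTime n d + 10
  · exact Or.inr (Or.inr (Or.inr (Or.inl ⟨k - climbTime n d, by omega, by omega⟩)))
  by_cases h5 : k ≤ climbTime n d + 16
  · exact Or.inr (Or.inr (Or.inr (Or.inr (Or.inl
      ⟨k - (climbTime n d + 10), by omega, by omega⟩))))
  · exact Or.inr (Or.inr (Or.inr (Or.inr (Or.inr ⟨k - (climbTime n d + 16), by omega⟩))))

theorem hikerLevel_step (k : ℕ) :
    hikerLevel n d α (k + 1) = hikerLevel n d α k + 1 ∨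
      hikerLevel n d α k = hikerLevel n d α (k + 1) + 1 := by
  rcases time_cases n d k with h | ⟨e, he, rfl⟩ | ⟨i, o, hi, ho, rfl⟩ | ⟨e, he, rfl⟩ |
    ⟨e, he, rfl⟩ | ⟨e, rfl⟩
  · rcases Nat.lt_or_ge k (n * (4 * d + 20)) with h' | h'
    · rw [hikerLevel_early n d α h, hikerLevel_early n d α h']; omega
    · have : k = n * (4 * d + 20) + 0 := by omega
      subst this
      rw [hikerLevel_descent n d α (by omega), add_assoc, hikerLevel_descent n d α (by omega)]
      omega
  · rcases Nat.lt_or_ge e 5 with h' | h'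
    · rw [hikerLevel_descent n d α he, add_assoc, hikerLevel_descent n d α (by omega)]; omega
    · have : e = 5 := by omega
      subst this
      rw [hikerLevel_descent n d α he]
      rcases Nat.eq_zero_or_pos n with rfl | hn
      · rw [show 0 * (4 * d + 20) + 5 + 1 = climbTime 0 d + 0 by simp [climbTime],
          hikerLevel_climb 0 d α (by omega)]
        omega
      · have := hikerLevel_gadget n d α hn (o := 0) (by omega)
        rw [if_neg (by omega), (hikerGadget_spec (α 0) 0).2.2.2.1 rfl, zero_mul] at this
        simp only [add_zero] at this
        rw [add_assoc, this]
        omega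
  · rw [hikerLevel_gadget n d α hi ho.le, add_assoc,
      hikerLevel_gadget n d α hi (show o + 1 ≤ 4 * d + 2 from ho)]
    have h1 := hikerGadget_step (α i) o
    obtain ⟨-, -, h2, -, -⟩ := hikerGadget_spec (α i) o
    split_ifs <;> omega
  · rcases Nat.lt_or_ge e 10 with h' | h'
    · rw [hikerLevel_climb n d α he, add_assoc, hikerLevel_climb n d α (by omega)]; omega
    · have : e = 10 := by omega
      subst this
      rw [hikerLevel_climb n d α he, hikerLevel_return n d α (k := 1) (by omega)]; omega
  · rcases Nat.lt_or_ge e 6 with h' | h'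
    · rw [hikerLevel_return n d α he, add_assoc, hikerLevel_return n d α (by omega)]; omega
    · have : e = 6 := by omega
      subst this
      rw [hikerLevel_return n d α he]
      have := hikerLevel_late n d α 1
      rw [add_assoc _ 10 6, this]; omega
  · rw [hikerLevel_late, add_assoc, hikerLevel_late]; omega

theorem hikerLevel_parity (k : ℕ) : hikerLevel n d α k % 2 = (k + 1) % 2 := by
  induction k with
  | zero => simp [hikerLevel]
  | succ k ih => have := hikerLevel_step n d α k; omega

theorem hikerLevel_le (k : ℕ) : hikerLevel n d α k ≤ 11 := by
  have h := hikerGadget_spec (α ((k - (n * (4 * d + 20) + 6)) / (4 * d + 2)))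
      ((k - (n * (4 * d + 20) + 6)) % (4 * d + 2))
  unfold hikerLevel
  split_ifs <;> omega

end hiker

/-! ### The dog's discrete walks -/

section walk

variable {n d : ℕ} {α β : ℕ → ℕ → Bool}

/-- The dog at position `m` is in range of the hiker at time `k`. -/
def InRange (n d : ℕ) (α β : ℕ → ℕ → Bool) (k m : ℕ) : Prop :=
  dogLevel d β m ≤ hikerLevel n d α k ∧ hikerLevel n d α k ≤ dogLevel d β m + 6

/-- These are the only places for the dog when the hiker is at level 1: around a block start, or
just behind the gadget. -/
theorem dogBlock_valley (row : ℕ → Bool) {o : ℕ} (ho : o < 4 * d + 20)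
    (h : dogBlock d row o ≤ 1) : o = 0 ∨ o = 1 ∨ o = 4 * d + 3 ∨ o = 4 * d + 19 := by
  unfold dogBlock at h
  split_ifs at h <;> omega

theorem dogBlock_eq_zero (row : ℕ → Bool) {o : ℕ} (h : dogBlock d row o = 0) : o = 0 := by
  unfold dogBlock at h
  split_ifs at h <;> omega

/-- The peak is a barrier for a hiker at level at most 4 and the only refuge for a hiker at level
11. -/
theorem dogBlock_peak (row : ℕ → Bool) {o : ℕ} :
    5 ≤ dogBlock d row o ↔ o = 4 * d + 7 := by
  have h1 := wave_spec ((o - 2) % 4) (row ((o - 2) / 4))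
  unfold dogBlock
  split_ifs <;> omega

theorem walk_near {y : ℕ → ℕ} {T : ℕ}
    (hy : ∀ k < T, y (k + 1) ≤ y k + 1 ∧ y k ≤ y (k + 1) + 1) (k e : ℕ) (h : k + e ≤ T) :
    y (k + e) ≤ y k + e ∧ y k ≤ y (k + e) + e := by
  induction e with
  | zero => simp
  | succ e ih =>
    have h1 := hy (k + e) (by omega)
    have h2 := ih (by omega)
    rw [← add_assoc k e 1]
    omega

theorem hikerLevel_low {k : ℕ} (h1 : n * (4 * d + 20) + 5 ≤ k) (h2 : k ≤ climbTime n d) :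
    hikerLevel n d α k ≤ 4 := by
  have h := hikerGadget_spec (α ((k - (n * (4 * d + 20) + 6)) / (4 * d + 2)))
      ((k - (n * (4 * d + 20) + 6)) % (4 * d + 2))
  unfold hikerLevel
  split_ifs <;> omega

/-- While the hiker passes the vector gadgets, the dog stays between two barriers. -/
theorem walk_between {y : ℕ → ℕ} {T j : ℕ}
    (hy : ∀ k < T, y (k + 1) ≤ y k + 1 ∧ y k ≤ y (k + 1) + 1)
    (hr : ∀ k ≤ T, InRange n d α β k (y k)) (hT : climbTime n d ≤ T)
    (h0 : y (n * (4 * d + 20) + 5) = j * (4 * d + 20)) (e : ℕ)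
    (he : n * (4 * d + 20) + 5 + e ≤ climbTime n d) :
    j * (4 * d + 20) < y (n * (4 * d + 20) + 5 + e) + 13 ∧
      y (n * (4 * d + 20) + 5 + e) < j * (4 * d + 20) + (4 * d + 7) := by
  induction e with
  | zero => rw [add_zero, h0]; omega
  | succ e ih =>
    have h1 := hy (n * (4 * d + 20) + 5 + e) (by omega)
    have h2 := ih (by omega)
    have h3 := (hr (n * (4 * d + 20) + 5 + (e + 1)) (by omega)).1
    have h4 := hikerLevel_low (α := α) (by omega) he
    rw [← add_assoc] at h3 h4 ⊢
    set z := y (n * (4 * d + 20) + 5 + e + 1)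
    -- A peak is out of range of the low hiker, and unit steps cannot jump over it.
    have hpeak : ∀ i, z ≠ i * (4 * d + 20) + (4 * d + 7) := by
      intro i hi
      rw [hi, dogLevel_block _ _ _ _ (by omega)] at h3
      have := (dogBlock_peak (d := d) (β i)).2 rfl
      omega
    have h5 := hpeak j
    -- Thirteen positions before the start of block `j` lies the peak of block `j - 1`.
    have h6 : z + 13 ≠ j * (4 * d + 20) := by
      intro h
      obtain ⟨i, rfl⟩ : ∃ i, j = i + 1 := ⟨j - 1, by
        rcases Nat.eq_zero_or_pos j with rfl | hj
        · omega
        · omega⟩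
      apply hpeak i
      rw [add_mul] at h
      omega
    omega

/-- Between the two neighbouring peaks the valleys of level at most 1 are those around the start of
block `j` and the one behind its gadget, so "crossed" and "not crossed" are the only cases. -/
theorem valley_between {j m : ℕ} (h : dogLevel d β m ≤ 1) (h1 : j * (4 * d + 20) < m + 13)
    (h2 : m < j * (4 * d + 20) + (4 * d + 7)) :
    (m ≤ j * (4 * d + 20) + 1 ∧ j * (4 * d + 20) ≤ m + 1) ∨
      m = j * (4 * d + 20) + (4 * d + 3) := by
  rcases Nat.lt_or_ge m (j * (4 * d + 20)) with hm | hm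
  · left
    obtain ⟨i, rfl⟩ : ∃ i, j = i + 1 := ⟨j - 1, by
        rcases Nat.eq_zero_or_pos j with rfl | hj
        · omega
        · omega⟩
    rw [add_mul, one_mul] at *
    obtain ⟨o, rfl⟩ := Nat.exists_eq_add_of_le (show i * (4 * d + 20) ≤ m by omega)
    rw [dogLevel_block _ _ _ _ (by omega)] at h
    have := dogBlock_valley (β i) (by omega) h
    omega
  · obtain ⟨o, rfl⟩ := Nat.exists_eq_add_of_le hm
    rw [dogLevel_block _ _ _ _ (by omega)] at h
    have := dogBlock_valley (β j) (by omega) h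
    omega

/-- Crossing a vector gadget of the dog while the hiker passes one of his is possible only if the
vectors are orthogonal. -/
theorem orthogonal_of_cross {y : ℕ → ℕ} {T i j : ℕ}
    (hy : ∀ k < T, y (k + 1) ≤ y k + 1 ∧ y k ≤ y (k + 1) + 1)
    (hr : ∀ k ≤ T, InRange n d α β k (y k)) (hT : climbTime n d ≤ T) (hi : i < n)
    (h1 : y (n * (4 * d + 20) + 6 + i * (4 * d + 2)) ≤ j * (4 * d + 20) + 1)
    (h2 : y (n * (4 * d + 20) + 6 + i * (4 * d + 2) + (4 * d + 2)) =
      j * (4 * d + 20) + (4 * d + 3)) (c : ℕ) (hc : c < d) :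
    α i c = false ∨ β j c = false := by
  have hi' : (i + 1) * (4 * d + 2) ≤ n * (4 * d + 2) := Nat.mul_le_mul_right _ hi
  rw [add_mul, one_mul] at hi'
  have hK : climbTime n d = n * (4 * d + 20) + 6 + n * (4 * d + 2) := rfl
  -- The dog has to gain at least `4 * d + 2` positions in `4 * d + 2` steps. Speed bounds from both
  -- ends therefore determine its position at the hiker's offset `4 * c + 3`, where the level of
  -- coordinate `c` is encoded.
  have h3 := walk_near hy (n * (4 * d + 20) + 6 + i * (4 * d + 2)) (4 * c + 3) (by omega)
  have h4 := walk_near hy (n * (4 * d + 20) + 6 + i * (4 * d + 2) + (4 * c + 3))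
    (4 * d + 2 - (4 * c + 3)) (by omega)
  rw [add_assoc _ (4 * c + 3), show 4 * c + 3 + (4 * d + 2 - (4 * c + 3)) = 4 * d + 2 by omega,
    h2] at h4
  have h5 : y (n * (4 * d + 20) + 6 + i * (4 * d + 2) + (4 * c + 3)) =
    j * (4 * d + 20) + (4 * c + 4) := by omega
  have h6 := (hr (n * (4 * d + 20) + 6 + i * (4 * d + 2) + (4 * c + 3)) (by omega)).1
  rw [h5, dogLevel_block _ _ _ _ (by omega), hikerLevel_gadget n d α hi (by omega),
    if_neg (by omega)] at h6
  have e1 : hikerGadget (α i) (4 * c + 3) = 1 + 2 * (!α i c).toNat := by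
    have h7 : (4 * c + 3 - 1) % 4 = 2 := by omega
    have h8 : (4 * c + 3 - 1) / 4 = c := by omega
    unfold hikerGadget
    rw [if_neg (by omega), h7, h8]
    simp [wave]
  have e2 : dogBlock d (β j) (4 * c + 4) = 2 + 2 * (β j c).toNat := by
    have h7 : (4 * c + 4 - 2) % 4 = 2 := by omega
    have h8 : (4 * c + 4 - 2) / 4 = c := by omega
    unfold dogBlock
    rw [if_neg (by omega), if_pos (by omega), h7, h8]
    simp [wave]
  rw [e1, e2] at h6
  cases hα : α i c <;> cases hβ : β j c <;> simp_all

/-- Without an orthogonal pair no gadget is ever crossed, so the dog is still near a block start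
when the final climb begins and misses every peak. The assumption `2 ≤ d` makes the gadget longer
than the climb. -/
theorem orthogonal_of_walk (hd : 2 ≤ d) {y : ℕ → ℕ} {T : ℕ}
    (hy : ∀ k < T, y (k + 1) ≤ y k + 1 ∧ y k ≤ y (k + 1) + 1)
    (hr : ∀ k ≤ T, InRange n d α β k (y k)) (hT : climbTime n d + 10 ≤ T)
    (hM : ∀ k ≤ T, y k ≤ n * (4 * d + 20) + 1) :
    ∃ i < n, ∃ j < n, ∀ c < d, α i c = false ∨ β j c = false := by
  by_contra! hno
  have hK : climbTime n d = n * (4 * d + 20) + 6 + n * (4 * d + 2) := rfl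
  -- At the bottom of his descent the hiker is at level 0, which the dog's line attains only at
  -- block starts.
  obtain ⟨j, hj⟩ : ∃ j, y (n * (4 * d + 20) + 5) = j * (4 * d + 20) := by
    have h1 := (hr (n * (4 * d + 20) + 5) (by omega)).1
    rw [hikerLevel_descent n d α le_rfl] at h1
    obtain ⟨j, o, ho, he⟩ := exists_block d (y (n * (4 * d + 20) + 5))
    rw [he, dogLevel_block _ _ _ _ ho] at h1
    have := dogBlock_eq_zero (d := d) (β j) (o := o) (by omega)
    exact ⟨j, by omega⟩
  have hb := walk_between hy hr (by omega) hj
  -- Induction over the hiker's gadgets: at each boundary the dog is still within one position of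
  -- the start of block `j`.
  have hlow : ∀ i ≤ n, y (n * (4 * d + 20) + 6 + i * (4 * d + 2)) ≤ j * (4 * d + 20) + 1 ∧
      j * (4 * d + 20) ≤ y (n * (4 * d + 20) + 6 + i * (4 * d + 2)) + 1 := by
    intro i
    induction i with
    | zero =>
      intro _
      have := hy (n * (4 * d + 20) + 5) (by omega)
      rw [hj, add_assoc _ 5 1] at this
      simp only [zero_mul, add_zero]
      omega
    | succ i ih =>
      intro hi
      have h1 := ih (by omega)
      have hi' : (i + 1) * (4 * d + 2) ≤ n * (4 * d + 2) := Nat.mul_le_mul_right _ hi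
      have h2 := (hr (n * (4 * d + 20) + 6 + i * (4 * d + 2) + (4 * d + 2)) (by
        rw [add_mul, one_mul] at hi'; omega)).1
      rw [hikerLevel_gadget n d α hi le_rfl, if_pos rfl] at h2
      rw [add_mul, one_mul] at hi' ⊢
      rw [← add_assoc (n * (4 * d + 20) + 6)]
      have h3 := hb (1 + i * (4 * d + 2) + (4 * d + 2)) (by omega)
      rw [show n * (4 * d + 20) + 5 + (1 + i * (4 * d + 2) + (4 * d + 2)) =
        n * (4 * d + 20) + 6 + i * (4 * d + 2) + (4 * d + 2) by omega] at h3
      rcases valley_between h2 h3.1 h3.2 with h | h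
      · exact h
      · exfalso
        -- The end of the line, position `M`, is a block start without a gadget; a valley behind it
        -- would exceed the bound `M + 1`.
        have hjn : j < n := by
          have h4 := hM (n * (4 * d + 20) + 6 + i * (4 * d + 2) + (4 * d + 2)) (by omega)
          rw [h] at h4
          by_contra! hjn
          have := Nat.mul_le_mul_right (4 * d + 20) hjn
          omega
        obtain ⟨c, hc, h5, h6⟩ := hno i hi j hjn
        rcases orthogonal_of_cross hy hr (by omega) hi h1.1 h c hc with h | h
        · exact h5 h
        · exact h6 h
  have h1 := hlow n le_rfl
  have h2 := walk_near hy (climbTime n d) 10 hT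
  have h3 := (hr (climbTime n d + 10) hT).2
  rw [hikerLevel_climb n d α le_rfl] at h3
  obtain ⟨i, o, ho, he⟩ := exists_block d (y (climbTime n d + 10))
  rw [he, dogLevel_block _ _ _ _ ho] at h3
  -- From within one position of the start, the next peak is at least `4 * d + 6` away and the
  -- previous one at least 12, both more than ten steps.
  have h4 := (dogBlock_peak (d := d) (β i) (o := o)).1 (by omega)
  rw [he, hK] at h2
  rcases Nat.lt_or_ge i j with hij | hij
  · have := Nat.mul_le_mul_right (4 * d + 20) hij
    rw [Nat.succ_eq_add_one, add_mul, one_mul] at this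
    omega
  · have := Nat.mul_le_mul_right (4 * d + 20) hij
    omega

/-- A walk of the dog that crosses gadget `j` while the hiker passes gadget `i`. -/
def dogWalk (n d i j k : ℕ) : ℕ :=
  if k ≤ n * (4 * d + 20) + 5 + i * (4 * d + 2) then min k (j * (4 * d + 20))
  else if k ≤ n * (4 * d + 20) + 6 + i * (4 * d + 2) + (4 * d + 2) then
    j * (4 * d + 20) + 1 + (k - (n * (4 * d + 20) + 6 + i * (4 * d + 2)))
  else if k ≤ climbTime n d + 6 then j * (4 * d + 20) + (4 * d + 3)
  else if k ≤ climbTime n d + 10 then j * (4 * d + 20) + (4 * d + 3) + (k - (climbTime n d + 6))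
  else if k ≤ climbTime n d + 16 then j * (4 * d + 20) + (4 * d + 7)
  else min (n * (4 * d + 20)) (j * (4 * d + 20) + (4 * d + 7) + (k - (climbTime n d + 16)))

section dogWalk

variable {i j : ℕ}

theorem dogWalk_step (hi : i < n) (hj : j < n) (k : ℕ) :
    dogWalk n d i j (k + 1) = dogWalk n d i j k ∨
      dogWalk n d i j (k + 1) = dogWalk n d i j k + 1 := by
  have hi' := Nat.mul_le_mul_right (4 * d + 2) (Nat.succ_le_of_lt hi)
  have hj' := Nat.mul_le_mul_right (4 * d + 20) (Nat.succ_le_of_lt hj)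
  rw [Nat.succ_eq_add_one, add_mul, one_mul] at hi' hj'
  unfold dogWalk climbTime
  split_ifs <;> omega

theorem dogWalk_zero : dogWalk n d i j 0 = 0 := by simp [dogWalk]

/-- `climbTime` is `2 * M + 6 - 18 * n`; after sixteen more steps fewer than `M` positions remain,
so time `4 * M` suffices. -/
theorem dogWalk_end (hi : i < n) (hj : j < n) :
    dogWalk n d i j (4 * (n * (4 * d + 20))) = n * (4 * d + 20) := by
  have hi' := Nat.mul_le_mul_right (4 * d + 2) (Nat.succ_le_of_lt hi)
  have hj' := Nat.mul_le_mul_right (4 * d + 20) (Nat.succ_le_of_lt hj)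
  have e : n * (4 * d + 20) = n * (4 * d + 2) + n * 18 := by ring
  rw [Nat.succ_eq_add_one, add_mul, one_mul] at hi' hj'
  unfold dogWalk climbTime
  split_ifs <;> omega

/-- The tall wave dominates the short ones. The hiker's wave is tall when his bit is 0 and the dog's
when its bit is 1, so orthogonality is domination in every coordinate. -/
theorem wave_mono {r : ℕ} {s t : Bool} (h : s = false ∨ t = true) : wave r s ≤ wave r t := by
  unfold wave
  rcases h with rfl | rfl
  · split_ifs <;> simp
  · have := Bool.toNat_le s
    split_ifs
    · simp only [Bool.toNat_true]; omega
    · exact le_rfl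

/-- The waiting places fit the phases: a block start at level 0 tolerates hiker levels 0 to 6, the
valley at level 1 tolerates 1 to 7, and the peak at level 5 tolerates 5 to 11. -/
theorem dogWalk_inRange (hi : i < n) (hj : j < n)
    (h : ∀ c < d, α i c = false ∨ β j c = false) (k : ℕ) :
    InRange n d α β k (dogWalk n d i j k) := by
  have hi' := Nat.mul_le_mul_right (4 * d + 2) (Nat.succ_le_of_lt hi)
  have hj' := Nat.mul_le_mul_right (4 * d + 20) (Nat.succ_le_of_lt hj)
  rw [Nat.succ_eq_add_one, add_mul, one_mul] at hi' hj'
  have hK : climbTime n d = n * (4 * d + 20) + 6 + n * (4 * d + 2) := rfl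
  have hfree : ∀ {k m}, 5 ≤ hikerLevel n d α k → hikerLevel n d α k ≤ 6 →
      InRange n d α β k m := fun {k m} h5 h6 => by
    have := dogLevel_le d β m
    exact ⟨by omega, by omega⟩
  unfold dogWalk
  split_ifs with h1 h2 h3 h4 h5
  · rcases Nat.le_total k (n * (4 * d + 20)) with hk | hk
    · have := hikerLevel_early n d α hk
      exact hfree (by omega) (by omega)
    · have e : min k (j * (4 * d + 20)) = j * (4 * d + 20) + 0 := by omega
      rw [e, InRange, dogLevel_block _ _ _ _ (by omega)]
      have : hikerLevel n d α k ≤ 6 := by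
        rcases Nat.le_total k (n * (4 * d + 20) + 5) with hk' | hk'
        · obtain ⟨e, rfl⟩ := Nat.exists_eq_add_of_le hk
          rw [hikerLevel_descent n d α (by omega)]; omega
        · have := hikerLevel_low (α := α) hk' (by omega)
          omega
      simp only [dogBlock, Nat.zero_le, if_true, zero_add, true_and]
      exact this
  · obtain ⟨u, rfl⟩ := Nat.exists_eq_add_of_le
      (show n * (4 * d + 20) + 6 + i * (4 * d + 2) ≤ k by omega)
    rw [Nat.add_sub_cancel_left, add_assoc (j * (4 * d + 20)), InRange,
      dogLevel_block _ _ _ _ (by omega), hikerLevel_gadget n d α hi (by omega)]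
    have h0 := hikerGadget_spec (α i) u
    rcases Nat.eq_zero_or_pos u with rfl | hu
    · rw [if_neg (by omega), h0.2.2.2.1 rfl]
      simp [dogBlock]
    · split_ifs with hu'
      · subst hu'
        unfold dogBlock
        split_ifs <;> omega
      · have hw : wave ((u - 1) % 4) (β j ((u - 1) / 4)) ≤
            wave ((u - 1) % 4) (!α i ((u - 1) / 4)) := by
          rcases Nat.lt_or_ge ((u - 1) / 4) d with hc | hc
          · refine wave_mono ?_
            rcases h _ hc with h | h
            · right; simp [h]
            · left; exact h
          -- Only `u = 4 * d + 1` remains: the column is outside the matrix, but both waves are at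
          -- 0.
          · rw [show (u - 1) % 4 = 0 by omega]
            simp [wave]
        unfold dogBlock hikerGadget at *
        rw [show 1 + u - 2 = u - 1 by omega]
        split_ifs at * <;> omega
  · have e1 : dogBlock d (β j) (4 * d + 3) = 1 := by
      unfold dogBlock
      split_ifs <;> omega
    rw [InRange, dogLevel_block _ _ _ _ (by omega), e1]
    rcases time_cases n d k with h | ⟨e, he, rfl⟩ | ⟨i', o, hi', ho, rfl⟩ | ⟨e, he, rfl⟩ |
      ⟨e, he, rfl⟩ | ⟨e, rfl⟩
    · omega
    · omega
    · rw [hikerLevel_gadget n d α hi' ho.le, if_neg (by omega)]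
      have := hikerGadget_spec (α i') o
      omega
    · rw [hikerLevel_climb n d α he]; omega
    · omega
    · omega
  · obtain ⟨v, rfl⟩ := Nat.exists_eq_add_of_le (show climbTime n d + 6 ≤ k by omega)
    rw [Nat.add_sub_cancel_left, add_assoc (j * (4 * d + 20)), InRange,
      dogLevel_block _ _ _ _ (by omega), add_assoc _ 6, hikerLevel_climb n d α (by omega)]
    unfold dogBlock
    split_ifs <;> omega
  · obtain ⟨v, rfl⟩ := Nat.exists_eq_add_of_le (show climbTime n d + 10 ≤ k by omega)
    have := (dogBlock_peak (d := d) (β j)).2 rfl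
    have := dogLevel_le d β (j * (4 * d + 20) + (4 * d + 7))
    rw [InRange, hikerLevel_return n d α (by omega)]
    rw [dogLevel_block _ _ _ _ (by omega)] at *
    omega
  · obtain ⟨v, rfl⟩ := Nat.exists_eq_add_of_le (show climbTime n d + 16 ≤ k by omega)
    have := hikerLevel_late n d α v
    exact hfree (by omega) (by omega)

end dogWalk

end walk

end BarkingReduction

/-! ### Piecewise linear interpolation -/

namespace BarkingReduction

/-- Piecewise linear interpolation of a sequence. -/
noncomputable def lin (v : ℕ → ℝ) (t : ℝ) : ℝ :=
  v ⌊t⌋₊ + (t - ⌊t⌋₊) * (v (⌊t⌋₊ + 1) - v ⌊t⌋₊)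

/-- At `θ = 1` adjacent pieces agree, so both endpoints are allowed and no later case split is
needed at integers. -/
theorem lin_natCast_add (v : ℕ → ℝ) (m : ℕ) {θ : ℝ} (h0 : 0 ≤ θ) (h1 : θ ≤ 1) :
    lin v (m + θ) = v m + θ * (v (m + 1) - v m) := by
  rcases h1.lt_or_eq with h | rfl
  · have : ⌊(m : ℝ) + θ⌋₊ = m := by
      rw [Nat.floor_eq_iff (by positivity)]; constructor <;> linarith
    rw [lin, this]; ring
  · have : ⌊(m : ℝ) + 1⌋₊ = m + 1 := by exact_mod_cast Nat.floor_natCast (R := ℝ) (m + 1)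
    rw [lin, this]; push_cast; ring

theorem lin_natCast (v : ℕ → ℝ) (m : ℕ) : lin v m = v m := by
  simpa using lin_natCast_add v m le_rfl zero_le_one

theorem exists_natCast_add {N : ℕ} (hN : 0 < N) {t : ℝ} (h0 : 0 ≤ t) (h1 : t ≤ N) :
    ∃ k < N, ∃ θ : ℝ, 0 ≤ θ ∧ θ ≤ 1 ∧ t = k + θ := by
  rcases h1.lt_or_eq with h | rfl
  · exact ⟨⌊t⌋₊, (Nat.floor_lt h0).2 h, t - ⌊t⌋₊, by linarith [Nat.floor_le h0],
      by linarith [Nat.lt_floor_add_one t], by ring⟩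
  · refine ⟨N - 1, by omega, 1, by norm_num, le_rfl, ?_⟩
    rw [Nat.cast_sub hN]; simp

theorem exists_natCast_add' {t : ℝ} (h0 : 0 ≤ t) :
    ∃ (k : ℕ) (θ : ℝ), 0 ≤ θ ∧ θ ≤ 1 ∧ t = k + θ :=
  ⟨⌊t⌋₊, t - ⌊t⌋₊, by linarith [Nat.floor_le h0], by linarith [Nat.lt_floor_add_one t], by ring⟩

theorem abs_sub_le_of_step {v : ℕ → ℝ} (hv : ∀ k, |v (k + 1) - v k| ≤ 1) (m e : ℕ) :
    |v (m + e) - v m| ≤ e := by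
  induction e with
  | zero => simp
  | succ e ih =>
    have := hv (m + e)
    rw [← add_assoc]
    push_cast
    rw [abs_le] at *
    constructor <;> linarith

theorem abs_lin_sub_le {v : ℕ → ℝ} (hv : ∀ k, |v (k + 1) - v k| ≤ 1) {s t : ℝ} (hs : 0 ≤ s)
    (ht : 0 ≤ t) : |lin v s - lin v t| ≤ |s - t| := by
  wlog hst : t ≤ s generalizing s t
  · rw [abs_sub_comm, abs_sub_comm s]
    exact this ht hs (le_of_not_ge hst)
  rw [abs_of_nonneg (sub_nonneg.2 hst)]
  have hlt := Nat.lt_floor_add_one t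
  have hls := Nat.floor_le hs
  have hlt' := Nat.floor_le ht
  have hls' := Nat.lt_floor_add_one s
  have hb : ∀ (θ : ℝ) k, 0 ≤ θ → |θ * (v (k + 1) - v k)| ≤ θ := fun θ k h => by
    rw [abs_mul, abs_of_nonneg h]
    exact mul_le_of_le_one_right h (hv k)
  unfold lin
  obtain ⟨e, he⟩ := Nat.exists_eq_add_of_le (Nat.floor_mono hst)
  rcases Nat.eq_zero_or_pos e with rfl | hpos
  · rw [add_zero] at he
    rw [he]
    have := hb (s - t) ⌊t⌋₊ (by linarith)
    convert this using 2
    ring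
  -- The interval is cut at its first and last interior integers, and the three increments are
  -- added.
  · obtain ⟨f, rfl⟩ : ∃ f, e = f + 1 := ⟨e - 1, by omega⟩
    have h1 := hb (s - ⌊s⌋₊) ⌊s⌋₊ (by linarith)
    have h2 := hb (⌊t⌋₊ + 1 - t) ⌊t⌋₊ (by linarith)
    have h3 := abs_sub_le_of_step hv (⌊t⌋₊ + 1) f
    rw [show ⌊t⌋₊ + 1 + f = ⌊s⌋₊ by omega] at h3
    have h4 : (⌊s⌋₊ : ℝ) = ⌊t⌋₊ + (f + 1) := by rw [he]; push_cast; ring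
    rw [abs_le] at *
    constructor <;> linarith

theorem lin_affine (p q : ℝ) {t : ℝ} (ht : 0 ≤ t) : lin (fun k => p + q * k) t = p + q * t := by
  obtain ⟨k, θ, h0, h1, rfl⟩ := exists_natCast_add' ht
  rw [lin_natCast_add _ _ h0 h1]; push_cast; ring

theorem lin_mul_add (p q : ℝ) (v : ℕ → ℝ) (t : ℝ) :
    lin (fun k => p * (v k + q)) t = p * (lin v t + q) := by
  unfold lin; ring

/-- Subdividing every piece into four does not change the interpolation. -/
theorem lin_subdivide (v : ℕ → ℝ) {t : ℝ} (ht : 0 ≤ t) :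
    lin (fun i => lin v ((i : ℝ) / 4)) t = lin v (t / 4) := by
  obtain ⟨i, θ, h0, h1, rfl⟩ := exists_natCast_add' ht
  rw [lin_natCast_add _ _ h0 h1]
  obtain ⟨m, r, hr, rfl⟩ : ∃ m r, r < 4 ∧ i = 4 * m + r :=
    ⟨i / 4, i % 4, Nat.mod_lt _ (by norm_num), (Nat.div_add_mod i 4).symm⟩
  have hr' : (r : ℝ) ≤ 3 := by exact_mod_cast (show r ≤ 3 by omega)
  have e1 : ((4 * m + r : ℕ) : ℝ) / 4 = m + r / 4 := by push_cast; ring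
  have e2 : ((4 * m + r + 1 : ℕ) : ℝ) / 4 = m + (r + 1) / 4 := by push_cast; ring
  have e3 : (((4 * m + r : ℕ) : ℝ) + θ) / 4 = m + (r + θ) / 4 := by push_cast; ring
  rw [e1, e2, e3, lin_natCast_add _ _ (by positivity) (by linarith),
    lin_natCast_add _ _ (by positivity) (by linarith),
    lin_natCast_add _ _ (by positivity) (by linarith)]
  ring

end BarkingReduction

/-! ### Polylines with edges of equal length -/

namespace Polyline

open BarkingReduction

theorem ofFn_cons_cons (v : ℕ → Plane) (N : ℕ) :
    (List.ofFn fun i : Fin (N + 2) => v i) =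
      v 0 :: v 1 :: List.ofFn fun i : Fin N => v (i + 2) := by
  simp [List.ofFn_succ]

theorem ofFn_shift_cons (v : ℕ → Plane) (N : ℕ) :
    (List.ofFn fun i : Fin (N + 1) => v (i + 1)) =
      v 1 :: List.ofFn fun i : Fin N => v (i + 2) := by
  simp [List.ofFn_succ]

theorem length_ofFn {c : ℝ} (N : ℕ) (v : ℕ → Plane) (hv : ∀ i < N, dist (v i) (v (i + 1)) = c) :
    length (List.ofFn fun i : Fin (N + 1) => v i) = N * c := by
  induction N generalizing v with
  | zero => simp [length]
  | succ N ih =>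
    have := ih (fun i => v (i + 1)) fun i hi => hv (i + 1) (by omega)
    rw [ofFn_shift_cons] at this
    rw [ofFn_cons_cons, length, this, hv 0 (by omega)]
    push_cast; ring

theorem point_ofFn {c : ℝ} (hc : 0 < c) (N : ℕ) (v : ℕ → Plane)
    (hv : ∀ i < N, dist (v i) (v (i + 1)) = c) {k : ℕ} (hk : k < N) {θ : ℝ} (h0 : 0 ≤ θ)
    (h1 : θ ≤ 1) :
    point (List.ofFn fun i : Fin (N + 1) => v i) ((k + θ) * c) =
      AffineMap.lineMap (v k) (v (k + 1)) θ := by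
  induction N generalizing v k with
  | zero => omega
  | succ N ih =>
    rw [ofFn_cons_cons, point, hv 0 (by omega)]
    rcases k with _ | k
    · have : (((0 : ℕ) : ℝ) + θ) * c ≤ c := by
        push_cast; nlinarith
      rw [if_pos this]
      congr 1
      push_cast
      field_simp
      ring
    · have := ih (fun i => v (i + 1)) (fun i hi => hv (i + 1) (by omega)) (k := k) (by omega)
      rw [ofFn_shift_cons] at this
      have e : (((k + 1 : ℕ) : ℝ) + θ) * c - c = (k + θ) * c := by push_cast; ring
      -- The first branch of `point` also contains the end of the first edge; there `k = 0` and `θ =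
      -- 0`, and both formulas give `v 1`.
      split_ifs with h
      · push_cast at h
        have hkθ : (k : ℝ) + θ = 0 := by
          have : (0 : ℝ) ≤ k := k.cast_nonneg
          nlinarith
        have hk0 : (k : ℝ) = 0 := by
          have : (0 : ℝ) ≤ k := k.cast_nonneg
          linarith
        have hθ : θ = 0 := by linarith
        have : k = 0 := by exact_mod_cast hk0
        subst this; subst hθ
        have e1 : (((0 + 1 : ℕ) : ℝ) + 0) * c / c = 1 := by
          push_cast; field_simp; norm_num
        rw [e1]; simp
      · rw [e, this]

/-- With edges of equal length `c`, arc length divided by `c` is a vertex index, so each coordinate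
is the interpolation of the vertex coordinates. -/
theorem point_apply {c : ℝ} (hc : 0 < c) {N : ℕ} (hN : 0 < N) (v : ℕ → Plane)
    (hv : ∀ i < N, dist (v i) (v (i + 1)) = c) {t : ℝ} (h0 : 0 ≤ t) (h1 : t ≤ N * c)
    (x : Fin 2) :
    point (List.ofFn fun i : Fin (N + 1) => v i) t x = lin (fun k => v k x) (t / c) := by
  obtain ⟨k, hk, θ, hθ0, hθ1, e⟩ := exists_natCast_add hN (div_nonneg h0 hc.le)
    ((div_le_iff₀ hc).2 h1)
  rw [e, lin_natCast_add _ _ hθ0 hθ1, (div_eq_iff hc.ne').1 e, point_ofFn hc N v hv hk hθ0 hθ1]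
  simp [AffineMap.lineMap_apply]
  ring

/-- An ascending polyline with edges of equal length is simple. -/
theorem isSimple_ofFn {c : ℝ} (hc : 0 < c) {N : ℕ} (hN : 0 < N) (v : ℕ → Plane)
    (hv : ∀ i < N, dist (v i) (v (i + 1)) = c) {p q : ℝ} (hq : q ≠ 0)
    (hy : ∀ k : ℕ, v k 1 = p + q * k) :
    IsSimple (List.ofFn fun i : Fin (N + 1) => v i) := by
  constructor
  · rw [List.nodup_ofFn]
    intro i j hij
    have : v i 1 = v j 1 := by rw [show v i = v j from hij]
    rw [hy, hy] at this
    have h2 : ((i : ℕ) : ℝ) = (j : ℕ) := mul_left_cancel₀ hq (by linarith)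
    exact Fin.ext (by exact_mod_cast h2)
  · intro s hs t ht hst
    rw [length_ofFn N v hv] at hs ht
    have : point (List.ofFn fun i : Fin (N + 1) => v i) s 1 =
      point (List.ofFn fun i : Fin (N + 1) => v i) t 1 := by
        rw [hst]
    rw [point_apply hc hN v hv hs.1 hs.2, point_apply hc hN v hv ht.1 ht.2] at this
    simp only [hy] at this
    rw [lin_affine _ _ (div_nonneg hs.1 hc.le), lin_affine _ _ (div_nonneg ht.1 hc.le)] at this
    have h2 : s / c = t / c := mul_left_cancel₀ hq (by linarith)
    field_simp at h2
    exact h2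

/-! ### Vanishing barking distance -/

theorem barkingDistance_eq_zero {ρ : ℝ} {s : ℝ≥0} {P Q : List Plane} {γ : ℝ → ℝ}
    (h : IsWalk s P Q γ)
    (hd : ∀ t ∈ Set.Icc 0 (length P), dist (point P t) (point Q (γ t)) ≤ ρ) :
    barkingDistance ρ s P Q = 0 := by
  refine le_antisymm ((iInf₂_le γ h).trans ?_) bot_le
  rw [MeasureTheory.setLIntegral_congr_fun measurableSet_Icc
    (g := fun _ => 0) fun t ht => by simp [threshold, not_lt.2 (hd t ht)]]
  simp

theorem abs_coord_le_dist (p q : Plane) (i : Fin 2) : |p i - q i| ≤ dist p q := by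
  rw [dist_eq_norm, ← Real.norm_eq_abs]
  exact PiLp.norm_apply_le (p - q) i

/-- If the barking distance vanishes, there are walks that almost keep to the barking radius at
all times. -/
theorem exists_walk_of_barkingDistance_eq_zero {ρ r : ℝ} (hr : ρ < r) {P Q : List Plane}
    (hlen : 0 < length P)
    (hP : ∀ s ∈ Set.Icc 0 (length P), ∀ t ∈ Set.Icc 0 (length P),
      |point P s 0 - point P t 0| ≤ |s - t|)
    (hQ : ∀ s ∈ Set.Icc 0 (length Q), ∀ t ∈ Set.Icc 0 (length Q),
      |point Q s 0 - point Q t 0| ≤ |s - t|)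
    (h : barkingDistance ρ 1 P Q = 0) :
    ∃ γ, IsWalk 1 P Q γ ∧ ∀ t ∈ Set.Icc 0 (length P), |point P t 0 - point Q (γ t) 0| ≤ r := by
  -- If the horizontal distance exceeds `r` at time `t`, it exceeds `r - 2 * e ≥ ρ` throughout time
  -- `e` before or after, since both points move horizontally at speed at most 1. As `e` is at most
  -- half the total time, one side fits. A walk with barking time below `e` is thus good at all
  -- times, and no minimising walk is needed.
  set e := min ((r - ρ) / 2) (length P / 2) with he
  have he0 : 0 < e := lt_min (by linarith) (by linarith)
  have he1 : e ≤ (r - ρ) / 2 := min_le_left _ _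
  have he2 : e ≤ length P / 2 := min_le_right _ _
  have hlt : barkingDistance ρ 1 P Q < ENNReal.ofReal e := by rw [h]; simpa using he0
  obtain ⟨γ, hγ⟩ := iInf_lt_iff.1 hlt
  obtain ⟨hw, hγ⟩ := iInf_lt_iff.1 hγ
  refine ⟨γ, hw, fun t ht => ?_⟩
  by_contra! hbad
  apply absurd hγ (not_lt.2 _)
  obtain ⟨a, ha0, ha1, ha2, ha3⟩ : ∃ a, 0 ≤ a ∧ a + e ≤ length P ∧ a ≤ t ∧ t ≤ a + e := by
    rcases le_total t (length P / 2) with h | h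
    · exact ⟨t, ht.1, by linarith, le_rfl, by linarith⟩
    · exact ⟨t - e, by linarith, by linarith [ht.2], by linarith, by linarith⟩
  have hsub : Set.Icc a (a + e) ⊆ Set.Icc 0 (length P) := Set.Icc_subset_Icc ha0 ha1
  calc ENNReal.ofReal e = ∫⁻ _ in Set.Icc a (a + e), 1 := by simp
    _ = ∫⁻ s in Set.Icc a (a + e), threshold ρ (point P s) (point Q (γ s)) := by
      refine MeasureTheory.setLIntegral_congr_fun measurableSet_Icc fun s hs => ?_
      have h1 := hP t ht s (hsub hs)
      have h2 := hQ _ (hw.mapsTo ht) _ (hw.mapsTo (hsub hs))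
      have h3 := hw.speed.dist_le_mul t ht s (hsub hs)
      rw [Real.dist_eq, Real.dist_eq, NNReal.coe_one, one_mul] at h3
      have h4 := abs_coord_le_dist (point P s) (point Q (γ s)) 0
      have h5 : |t - s| ≤ e := by
        rw [abs_le]; constructor <;> linarith [hs.1, hs.2]
      have h6 : |point P t 0 - point Q (γ t) 0| ≤ |point P t 0 - point P s 0| +
          |point Q (γ t) 0 - point Q (γ s) 0| + |point P s 0 - point Q (γ s) 0| := by
        rw [abs_sub_comm (point Q (γ t) 0)]
        calc _ = |(point P t 0 - point P s 0) + (point Q (γ s) 0 - point Q (γ t) 0) +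
              (point P s 0 - point Q (γ s) 0)| := by congr 1; ring
          _ ≤ _ := (abs_add_le _ _).trans (add_le_add_left (abs_add_le _ _) _)
      have : ρ < dist (point P s) (point Q (γ s)) := by linarith
      simp [threshold, this]
    _ ≤ _ := MeasureTheory.lintegral_mono_set hsub

end Polyline

/-! ### From walks on the polylines to discrete walks and back -/

namespace BarkingReduction

section discrete

variable {n d : ℕ} {α β : ℕ → ℕ → Bool}

/-- The levels of the hiker, as real numbers. -/
noncomputable def hikerReal (n d : ℕ) (α : ℕ → ℕ → Bool) (k : ℕ) : ℝ := hikerLevel n d α k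

/-- The levels of the dog's polyline, as real numbers. -/
noncomputable def dogReal (d : ℕ) (β : ℕ → ℕ → Bool) (m : ℕ) : ℝ := dogLevel d β m

theorem abs_hikerReal_step (k : ℕ) : |hikerReal n d α (k + 1) - hikerReal n d α k| = 1 := by
  unfold hikerReal
  rcases hikerLevel_step n d α k with h | h <;> rw [h] <;> push_cast <;> simp

theorem abs_dogReal_step (k : ℕ) : |dogReal d β (k + 1) - dogReal d β k| = 1 := by
  unfold dogReal
  rcases dogLevel_step d β k with h | h <;> rw [h] <;> push_cast <;> simp

/-- Rounding the positions of a dog to positions of the right parity. -/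
theorem exists_discrete_walk {T M : ℕ} {s : ℕ → ℝ} (hs0 : ∀ k ≤ T, 0 ≤ s k)
    (hs1 : ∀ k ≤ T, s k ≤ M) (hs : ∀ k < T, |s (k + 1) - s k| ≤ 1)
    (hr : ∀ k ≤ T, |hikerReal n d α k - (lin (dogReal d β) (s k) + 3)| ≤ 7 / 2) :
    ∃ y : ℕ → ℕ, (∀ k < T, y (k + 1) ≤ y k + 1 ∧ y k ≤ y (k + 1) + 1) ∧
      (∀ k ≤ T, InRange n d α β k (y k)) ∧ ∀ k ≤ T, y k ≤ M + 1 := by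
  -- The integer of the parity of `k + 1` in the interval from `s k - 1` (excluded) to `s k + 1`
  -- (included).
  set z : ℕ → ℤ := fun k => k + 1 + 2 * ⌊(s k - k) / 2⌋ with hz
  have hz1 : ∀ k, (z k : ℝ) ≤ s k + 1 := fun k => by
    have := Int.floor_le ((s k - k) / 2)
    simp only [hz]; push_cast; linarith
  have hz2 : ∀ k, s k - 1 < z k := fun k => by
    have := Int.lt_floor_add_one ((s k - k) / 2)
    simp only [hz]; push_cast; linarith
  have hz0 : ∀ k ≤ T, 0 ≤ z k := fun k hk => by
    have h1 := hz2 k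
    have h2 := hs0 k hk
    have : (-1 : ℝ) < z k := by linarith
    have : (-1 : ℤ) < z k := by exact_mod_cast this
    omega
  have hcast : ∀ k ≤ T, ((z k).toNat : ℤ) = z k := fun k hk => Int.toNat_of_nonneg (hz0 k hk)
  refine ⟨fun k => (z k).toNat, fun k hk => ?_, fun k hk => ?_, fun k hk => ?_⟩
  · have h1 := hcast k hk.le
    have h2 := hcast (k + 1) hk
    have h3 := abs_le.1 (hs k hk)
    -- The quantity `(s k - k) / 2` drops by an amount between 0 and 1, so its floor drops by 0 or 1
    -- and `z` moves by exactly one.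
    have h4 : ⌊(s (k + 1) - (k + 1 : ℕ)) / 2⌋ ≤ ⌊(s k - k) / 2⌋ := by
      apply Int.floor_mono; push_cast; linarith
    have h5 : ⌊(s k - k) / 2⌋ - 1 ≤ ⌊(s (k + 1) - (k + 1 : ℕ)) / 2⌋ := by
      rw [← Int.floor_sub_one]
      apply Int.floor_mono; push_cast; linarith
    simp only [hz] at h1 h2 ⊢
    push_cast at h2 h4 h5 ⊢
    omega
  · have hy := hcast k hk
    set y := (z k).toNat with hydef
    have hyr : (y : ℝ) = z k := by exact_mod_cast hy
    have h1 := hz1 k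
    have h2 := hz2 k
    rw [← hyr] at h1 h2
    have hlip := abs_lin_sub_le (v := dogReal d β) (fun k => (abs_dogReal_step k).le) (hs0 k hk)
      (show (0 : ℝ) ≤ y from y.cast_nonneg)
    rw [lin_natCast] at hlip
    have h3 : |s k - y| ≤ 1 := by rw [abs_le]; constructor <;> linarith
    have h4 := abs_le.1 (hr k hk)
    have h5 := abs_le.1 (hlip.trans h3)
    have hp1 := hikerLevel_parity n d α k
    have hp2 := dogLevel_parity d β y
    unfold hikerReal at h4
    unfold dogReal at h5
    unfold dogReal at h4
    -- Rounding costs at most 1, so hiker level minus dog level lies between `-3/2` and `15/2`. It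
    -- is even, hence between 0 and 6.
    have h6 : (hikerLevel n d α k : ℝ) < (dogLevel d β y + 8 : ℕ) := by push_cast; linarith
    have h7 : (dogLevel d β y : ℝ) < (hikerLevel n d α k + 2 : ℕ) := by push_cast; linarith
    have h8 := Nat.cast_lt.1 h6
    have h9 := Nat.cast_lt.1 h7
    have hpz : (y : ℤ) % 2 = (k + 1) % 2 := by rw [hy]; simp only [hz]; omega
    exact ⟨show dogLevel d β y ≤ _ by omega, show _ ≤ dogLevel d β y + 6 by omega⟩
  · have h1 := hcast k hk
    have h2 : (z k : ℝ) ≤ M + 1 := (hz1 k).trans (by linarith [hs1 k hk])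
    have h3 : z k ≤ M + 1 := by exact_mod_cast h2
    simp only
    omega

end discrete

/-! ### The polylines -/

section polylines

variable (a b : ℕ) (hb : 0 < b) (n d : ℕ) (α β : ℕ → ℕ → Bool)

/-- The number of edges of both polylines. -/
def edges (n d : ℕ) : ℕ := 4 * (n * (4 * d + 20))

/-- The levels of the dog's polyline after subdivision of its edges, in quarters. -/
def dogQuarter (d : ℕ) (β : ℕ → ℕ → Bool) (i : ℕ) : ℕ :=
  (4 - i % 4) * dogLevel d β (i / 4) + i % 4 * dogLevel d β (i / 4 + 1)

/-- The vertices of the hiker's polyline. -/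
def hikerPoint (k : ℕ) : RatPoint where
  x := (a * 8 * (edges n d + 1) * hikerLevel n d α k : ℕ)
  y := (a * 4 * (k + 1) : ℕ)
  den := b * 8 * (edges n d + 1)
  den_pos := by positivity

/-- The vertices of the dog's polyline. -/
def dogPoint (i : ℕ) : RatPoint where
  -- Twelve quarters are the shift by three levels that makes the range condition symmetric.
  x := (a * 2 * (edges n d + 1) * (dogQuarter d β i + 12) : ℕ)
  y := -(a * (i + 1) : ℕ)
  den := b * 8 * (edges n d + 1)
  den_pos := by positivity

theorem dogQuarter_eq (i : ℕ) : (dogQuarter d β i : ℝ) = 4 * lin (dogReal d β) ((i : ℝ) / 4) := by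
  have hr : i % 4 ≤ 4 := (Nat.mod_lt i (by norm_num)).le
  have hr' : ((i % 4 : ℕ) : ℝ) ≤ 4 := by exact_mod_cast hr
  have e : (i : ℝ) / 4 = (i / 4 : ℕ) + ((i % 4 : ℕ) : ℝ) / 4 := by
    have : (i : ℝ) = ((4 * (i / 4) + i % 4 : ℕ) : ℝ) := by rw [Nat.div_add_mod]
    rw [this]; push_cast; ring_nf
  rw [e, lin_natCast_add _ _ (by positivity) (by linarith)]
  unfold dogQuarter dogReal
  push_cast [Nat.cast_sub hr]
  ring

theorem hikerPoint_zero (k : ℕ) :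
    (hikerPoint a b hb n d α k).toPlane 0 = a / b * (hikerReal n d α k + 0) := by
  have : (b : ℝ) ≠ 0 := by positivity
  simp [RatPoint.toPlane, hikerPoint, hikerReal]
  field_simp

theorem hikerPoint_one (k : ℕ) :
    (hikerPoint a b hb n d α k).toPlane 1 =
      a / b / (2 * (edges n d + 1)) + a / b / (2 * (edges n d + 1)) * k := by
  have : (b : ℝ) ≠ 0 := by positivity
  simp [RatPoint.toPlane, hikerPoint]
  field_simp
  ring

theorem dogPoint_zero (i : ℕ) :
    (dogPoint a b hb n d β i).toPlane 0 = a / b * (lin (dogReal d β) ((i : ℝ) / 4) + 3) := by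
  have : (b : ℝ) ≠ 0 := by positivity
  have h := dogQuarter_eq d β i
  simp only [RatPoint.toPlane, dogPoint, PiLp.toLp_apply, Matrix.cons_val_zero]
  push_cast
  rw [h]
  field_simp
  ring

theorem dogPoint_one (i : ℕ) :
    (dogPoint a b hb n d β i).toPlane 1 =
      -(a / b / (8 * (edges n d + 1))) + -(a / b / (8 * (edges n d + 1))) * i := by
  have : (b : ℝ) ≠ 0 := by positivity
  simp [RatPoint.toPlane, dogPoint]
  field_simp
  ring

/-- The length of the edges of the hiker's polyline. -/
noncomputable def edgeLength (a b n d : ℕ) : ℝ :=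
  √((a / b : ℝ) ^ 2 + (a / b / (2 * (edges n d + 1))) ^ 2)

theorem dist_hikerPoint (k : ℕ) :
    dist (hikerPoint a b hb n d α k).toPlane (hikerPoint a b hb n d α (k + 1)).toPlane =
      edgeLength a b n d := by
  rw [EuclideanSpace.dist_eq, Fin.sum_univ_two, edgeLength, Real.dist_eq, Real.dist_eq, sq_abs,
    sq_abs, hikerPoint_zero, hikerPoint_zero, hikerPoint_one, hikerPoint_one]
  have h : (hikerReal n d α (k + 1) - hikerReal n d α k) ^ 2 = 1 := by
    rw [← sq_abs, abs_hikerReal_step, one_pow]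
  congr 2
  · linear_combination (a / b : ℝ) ^ 2 * h
  · push_cast; ring

theorem lin_quarter_step (i : ℕ) :
    (lin (dogReal d β) (((i + 1 : ℕ) : ℝ) / 4) - lin (dogReal d β) ((i : ℝ) / 4)) ^ 2 =
      1 / 16 := by
  obtain ⟨m, r, hr, rfl⟩ : ∃ m r, r < 4 ∧ i = 4 * m + r :=
    ⟨i / 4, i % 4, Nat.mod_lt _ (by norm_num), (Nat.div_add_mod i 4).symm⟩
  have hr' : (r : ℝ) ≤ 3 := by exact_mod_cast (show r ≤ 3 by omega)
  have e1 : ((4 * m + r : ℕ) : ℝ) / 4 = m + r / 4 := by push_cast; ring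
  have e2 : ((4 * m + r + 1 : ℕ) : ℝ) / 4 = m + (r + 1) / 4 := by push_cast; ring
  have h : (dogReal d β (m + 1) - dogReal d β m) ^ 2 = 1 := by
    rw [← sq_abs, abs_dogReal_step, one_pow]
  rw [e1, e2, lin_natCast_add _ _ (by positivity) (by linarith),
    lin_natCast_add _ _ (by positivity) (by linarith)]
  linear_combination (1 / 16 : ℝ) * h

/-- The drift per edge is also a quarter of the hiker's, so four edges of the dog are exactly as
long as one of the hiker. Unit speed thus means one level step per time unit for both. -/
theorem dist_dogPoint (i : ℕ) :
    dist (dogPoint a b hb n d β i).toPlane (dogPoint a b hb n d β (i + 1)).toPlane =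
      edgeLength a b n d / 4 := by
  have e : edgeLength a b n d / 4 =
      √(((a / b : ℝ) ^ 2 + (a / b / (2 * (edges n d + 1))) ^ 2) / 4 ^ 2) := by
    rw [Real.sqrt_div' _ (by positivity), Real.sqrt_sq (by norm_num), edgeLength]
  rw [e, EuclideanSpace.dist_eq, Fin.sum_univ_two, Real.dist_eq, Real.dist_eq, sq_abs,
    sq_abs, dogPoint_zero, dogPoint_zero, dogPoint_one, dogPoint_one]
  have h := lin_quarter_step d β i
  congr 1
  rw [add_div]
  congr 1
  · linear_combination (a / b : ℝ) ^ 2 * h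
  · push_cast; field_simp; ring

variable {a b n d}

/-- The drift only lengthens edges, so horizontal speeds are at most 1. -/
theorem edgeLength_ge : (a / b : ℝ) ≤ edgeLength a b n d := by
  refine Real.le_sqrt_of_sq_le ?_
  have := sq_nonneg (a / b / (2 * (edges n d + 1)) : ℝ)
  linarith

theorem edgeLength_pos (ha : 0 < a) (hb : 0 < b) : 0 < edgeLength a b n d :=
  lt_of_lt_of_le (by positivity) edgeLength_ge

/-- The hiker's polyline. -/
noncomputable def hikerLine (a b : ℕ) (hb : 0 < b) (n d : ℕ) (α : ℕ → ℕ → Bool) : List Plane :=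
  ratPolyline fun k : Fin (edges n d + 1) => hikerPoint a b hb n d α k

/-- The dog's polyline. -/
noncomputable def dogLine (a b : ℕ) (hb : 0 < b) (n d : ℕ) (β : ℕ → ℕ → Bool) : List Plane :=
  ratPolyline fun i : Fin (edges n d + 1) => dogPoint a b hb n d β i

theorem length_hikerLine :
    Polyline.length (hikerLine a b hb n d α) = edges n d * edgeLength a b n d :=
  Polyline.length_ofFn _ (fun k => (hikerPoint a b hb n d α k).toPlane)
    fun k _ => dist_hikerPoint a b hb n d α k

theorem length_dogLine :
    Polyline.length (dogLine a b hb n d β) = edges n d * (edgeLength a b n d / 4) :=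
  Polyline.length_ofFn _ (fun k => (dogPoint a b hb n d β k).toPlane)
    fun k _ => dist_dogPoint a b hb n d β k

theorem edges_pos (hn : 1 ≤ n) : 0 < edges n d := by unfold edges; positivity

theorem hikerLine_zero (ha : 0 < a) (hn : 1 ≤ n) {t : ℝ}
    (h0 : 0 ≤ t) (h1 : t ≤ edges n d * edgeLength a b n d) :
    Polyline.point (hikerLine a b hb n d α) t 0 =
      a / b * lin (hikerReal n d α) (t / edgeLength a b n d) := by
  have := Polyline.point_apply (edgeLength_pos ha hb) (edges_pos hn)
    (fun k => (hikerPoint a b hb n d α k).toPlane) (fun k _ => dist_hikerPoint a b hb n d α k)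
    h0 h1 0
  simp only [hikerPoint_zero] at this
  rw [lin_mul_add, add_zero] at this
  exact this

theorem hikerLine_one (ha : 0 < a) (hn : 1 ≤ n) {t : ℝ}
    (h0 : 0 ≤ t) (h1 : t ≤ edges n d * edgeLength a b n d) :
    Polyline.point (hikerLine a b hb n d α) t 1 =
      a / b / (2 * (edges n d + 1)) +
        a / b / (2 * (edges n d + 1)) * (t / edgeLength a b n d) := by
  have := Polyline.point_apply (edgeLength_pos ha hb) (edges_pos hn)
    (fun k => (hikerPoint a b hb n d α k).toPlane) (fun k _ => dist_hikerPoint a b hb n d α k)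
    h0 h1 1
  simp only [hikerPoint_one] at this
  rwa [lin_affine _ _ (div_nonneg h0 (edgeLength_pos ha hb).le)] at this

theorem dogLine_zero (ha : 0 < a) (hn : 1 ≤ n) {t : ℝ}
    (h0 : 0 ≤ t) (h1 : t ≤ edges n d * (edgeLength a b n d / 4)) :
    Polyline.point (dogLine a b hb n d β) t 0 =
      a / b * (lin (dogReal d β) (t / edgeLength a b n d) + 3) := by
  have hl := edgeLength_pos (n := n) (d := d) ha hb
  have := Polyline.point_apply (c := edgeLength a b n d / 4) (by linarith) (edges_pos hn)
    (fun k => (dogPoint a b hb n d β k).toPlane) (fun k _ => dist_dogPoint a b hb n d β k) h0 h1 0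
  simp only [dogPoint_zero] at this
  rw [lin_mul_add _ _ (fun i : ℕ => lin (dogReal d β) ((i : ℝ) / 4)),
    lin_subdivide _ (by positivity)] at this
  rw [show t / edgeLength a b n d = t / (edgeLength a b n d / 4) / 4 by field_simp]
  exact this

theorem dogLine_one (ha : 0 < a) (hn : 1 ≤ n) {t : ℝ}
    (h0 : 0 ≤ t) (h1 : t ≤ edges n d * (edgeLength a b n d / 4)) :
    Polyline.point (dogLine a b hb n d β) t 1 =
      -(a / b / (8 * (edges n d + 1))) +
        -(a / b / (8 * (edges n d + 1))) * (t / (edgeLength a b n d / 4)) := by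
  have hl := edgeLength_pos (n := n) (d := d) ha hb
  have := Polyline.point_apply (c := edgeLength a b n d / 4) (by linarith) (edges_pos hn)
    (fun k => (dogPoint a b hb n d β k).toPlane) (fun k _ => dist_dogPoint a b hb n d β k) h0 h1 1
  simp only [dogPoint_one] at this
  rwa [lin_affine _ _ (by positivity)] at this

theorem isSimple_hikerLine (ha : 0 < a) (hn : 1 ≤ n) :
    Polyline.IsSimple (hikerLine a b hb n d α) :=
  Polyline.isSimple_ofFn (edgeLength_pos ha hb) (edges_pos hn)
    (fun k => (hikerPoint a b hb n d α k).toPlane) (fun k _ => dist_hikerPoint a b hb n d α k)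
    (by positivity) (hikerPoint_one a b hb n d α)

theorem isSimple_dogLine (ha : 0 < a) (hn : 1 ≤ n) :
    Polyline.IsSimple (dogLine a b hb n d β) :=
  Polyline.isSimple_ofFn (c := edgeLength a b n d / 4)
    (by linarith [edgeLength_pos (n := n) (d := d) ha hb]) (edges_pos hn)
    (fun k => (dogPoint a b hb n d β k).toPlane) (fun k _ => dist_dogPoint a b hb n d β k)
    (neg_ne_zero.2 (by positivity)) (dogPoint_one a b hb n d β)

/-- The hiker's line lies strictly above the horizontal axis and the dog's strictly below. -/
theorem disjoint_carrier (ha : 0 < a) (hn : 1 ≤ n) :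
    Disjoint (Polyline.carrier (hikerLine a b hb n d α))
      (Polyline.carrier (dogLine a b hb n d β)) := by
  have hl := edgeLength_pos (n := n) (d := d) ha hb
  rw [Set.disjoint_left]
  rintro _ ⟨s, hs, rfl⟩ ⟨t, ht, hst⟩
  rw [length_hikerLine] at hs
  rw [length_dogLine] at ht
  have h1 := hikerLine_one hb α ha hn hs.1 hs.2
  have h2 := dogLine_one hb β ha hn ht.1 ht.2
  rw [hst, h1] at h2
  have hs0 := hs.1
  have ht0 := ht.1
  have h3 : (0 : ℝ) < a / b / (2 * (edges n d + 1)) := by positivity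
  have h4 : (0 : ℝ) < a / b / (8 * (edges n d + 1)) := by positivity
  have h5 : 0 ≤ s / edgeLength a b n d := by positivity
  have h6 : 0 ≤ t / (edgeLength a b n d / 4) := by positivity
  nlinarith


/-! ### Correctness of the reduction -/

/-- Two vectors of the families have no common nonzero coordinate. -/
def HasOrthogonalPair (n d : ℕ) (α β : ℕ → ℕ → Bool) : Prop :=
  ∃ i < n, ∃ j < n, ∀ c < d, α i c = false ∨ β j c = false

/-- A walk that keeps the horizontal distance within `7/2 * (a / b)` is sampled when the hiker is at
a vertex; positions in units of the edge length then satisfy the hypotheses of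
`exists_discrete_walk`. -/
theorem hasOrthogonalPair_of_barkingDistance (ha : 0 < a) (hn : 1 ≤ n) (hd : 2 ≤ d) {ρ : ℝ}
    (hρ : ρ < 7 / 2 * (a / b))
    (h : Polyline.barkingDistance ρ 1 (hikerLine a b hb n d α) (dogLine a b hb n d β) = 0) :
    HasOrthogonalPair n d α β := by
  have hl := edgeLength_pos (n := n) (d := d) ha hb
  have hle := edgeLength_ge (a := a) (b := b) (n := n) (d := d)
  have hT : (0 : ℝ) < edges n d := by exact_mod_cast edges_pos hn
  have hu : (0 : ℝ) < a / b := by positivity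
  have hscale : ∀ s t : ℝ, a / b * |s / edgeLength a b n d - t / edgeLength a b n d| ≤ |s - t| := by
    intro s t
    rw [← sub_div, abs_div, abs_of_pos hl, ← mul_div_assoc, div_le_iff₀ hl, mul_comm]
    exact mul_le_mul_of_nonneg_left hle (abs_nonneg _)
  obtain ⟨γ, hw, hγ⟩ := Polyline.exists_walk_of_barkingDistance_eq_zero hρ
    (by rw [length_hikerLine]; positivity)
    (fun s hs t ht => by
      rw [length_hikerLine] at hs ht
      rw [hikerLine_zero hb α ha hn hs.1 hs.2, hikerLine_zero hb α ha hn ht.1 ht.2, ← mul_sub,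
        abs_mul, abs_of_pos hu]
      exact (mul_le_mul_of_nonneg_left (abs_lin_sub_le (fun k => (abs_hikerReal_step k).le)
        (div_nonneg hs.1 hl.le) (div_nonneg ht.1 hl.le)) hu.le).trans (hscale s t))
    (fun s hs t ht => by
      rw [length_dogLine] at hs ht
      rw [dogLine_zero hb β ha hn hs.1 hs.2, dogLine_zero hb β ha hn ht.1 ht.2, ← mul_sub,
        abs_mul, abs_of_pos hu, add_sub_add_right_eq_sub]
      exact (mul_le_mul_of_nonneg_left (abs_lin_sub_le (fun k => (abs_dogReal_step k).le)
        (div_nonneg hs.1 hl.le) (div_nonneg ht.1 hl.le)) hu.le).trans (hscale s t)) h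
  have hmem : ∀ k ≤ edges n d, (k : ℝ) * edgeLength a b n d ∈
      Set.Icc 0 (Polyline.length (hikerLine a b hb n d α)) := fun k hk => by
    rw [length_hikerLine]
    have : (k : ℝ) ≤ edges n d := by exact_mod_cast hk
    exact ⟨by positivity, mul_le_mul_of_nonneg_right this hl.le⟩
  have hmaps := fun k hk => hw.mapsTo (hmem k hk)
  rw [length_dogLine] at hmaps
  have hed : (edges n d : ℝ) = 4 * (n * (4 * d + 20) : ℕ) := by
    unfold edges; push_cast; ring
  obtain ⟨y, hy, hr, hM⟩ := exists_discrete_walk (n := n) (d := d) (α := α) (β := β)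
    (T := edges n d) (M := n * (4 * d + 20))
    (s := fun k => γ (k * edgeLength a b n d) / edgeLength a b n d)
    (fun k hk => div_nonneg (hmaps k hk).1 hl.le)
    (fun k hk => by
      have := (hmaps k hk).2
      rw [hed] at this
      rw [div_le_iff₀ hl]
      linarith)
    (fun k hk => by
      have := hw.speed.dist_le_mul _ (hmem (k + 1) hk) _ (hmem k hk.le)
      rw [Real.dist_eq, Real.dist_eq, NNReal.coe_one, one_mul, ← sub_mul] at this
      push_cast at this ⊢
      rw [← sub_div, abs_div, abs_of_pos hl, div_le_one hl]
      refine this.trans ?_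
      rw [add_sub_cancel_left, one_mul, abs_of_pos hl])
    (fun k hk => by
      have h1 := hγ _ (hmem k hk)
      have h2 := hmem k hk
      rw [length_hikerLine] at h2
      rw [hikerLine_zero hb α ha hn h2.1 h2.2,
        dogLine_zero hb β ha hn (hmaps k hk).1 (hmaps k hk).2, ← mul_sub, abs_mul, abs_of_pos hu,
        mul_div_cancel_right₀ _ hl.ne', lin_natCast, mul_comm (7 / 2 : ℝ)] at h1
      exact le_of_mul_le_mul_left h1 hu)
  refine orthogonal_of_walk hd hy hr ?_ hM
  unfold climbTime edges
  have e : n * (4 * d + 20) = n * (4 * d + 2) + n * 18 := by ring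
  omega

/-- In each step the walk waits or advances along a single unit edge, so composing the
interpolations is again linear on the step. -/
theorem lin_comp_step (v : ℕ → ℝ) (y : ℕ → ℕ) (k : ℕ) (hy : y (k + 1) = y k ∨ y (k + 1) = y k + 1)
    {θ : ℝ} (h0 : 0 ≤ θ) (h1 : θ ≤ 1) :
    lin v (lin (fun k => (y k : ℝ)) (k + θ)) = v (y k) + θ * (v (y (k + 1)) - v (y k)) := by
  rw [lin_natCast_add _ _ h0 h1]
  rcases hy with h | h
  · rw [h, sub_self, mul_zero, add_zero, sub_self, mul_zero, add_zero, lin_natCast]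
  · rw [h]
    push_cast
    rw [add_sub_cancel_left, mul_one, lin_natCast_add _ _ h0 h1]

theorem barkingDistance_of_hasOrthogonalPair (ha : 0 < a) (hn : 1 ≤ n) {ρ : ℝ}
    (hρ : 13 / 4 * (a / b) ≤ ρ) (h : HasOrthogonalPair n d α β) :
    Polyline.barkingDistance ρ 1 (hikerLine a b hb n d α) (dogLine a b hb n d β) = 0 := by
  obtain ⟨i, hi, j, hj, hij⟩ := h
  have hl := edgeLength_pos (n := n) (d := d) ha hb
  have hu : (0 : ℝ) < a / b := by positivity
  have hed : (edges n d : ℝ) = 4 * (n * (4 * d + 20) : ℕ) := by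
    unfold edges; push_cast; ring
  set ℓ := edgeLength a b n d with hℓ
  set y := dogWalk n d i j with hydef
  have hstep : ∀ k, y (k + 1) = y k ∨ y (k + 1) = y k + 1 := dogWalk_step hi hj
  have hmono : Monotone y := monotone_nat_of_le_succ fun k => by have := hstep k; omega
  have hend : y (edges n d) = n * (4 * d + 20) := dogWalk_end hi hj
  set f : ℝ → ℝ := lin fun k => (y k : ℝ) with hf
  have hlip : ∀ s t : ℝ, 0 ≤ s → 0 ≤ t → |f s - f t| ≤ |s - t| := fun s t hs ht =>
    abs_lin_sub_le (fun k => by rcases hstep k with h | h <;> rw [h] <;> simp) hs ht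
  have hsplit : ∀ t ∈ Set.Icc 0 (Polyline.length (hikerLine a b hb n d α)),
      ∃ k < edges n d, ∃ θ : ℝ, 0 ≤ θ ∧ θ ≤ 1 ∧ t / ℓ = k + θ := fun t ht => by
    rw [length_hikerLine] at ht
    exact exists_natCast_add (edges_pos hn) (div_nonneg ht.1 hl.le) ((div_le_iff₀ hl).2 ht.2)
  have hmaps : ∀ t ∈ Set.Icc 0 (Polyline.length (hikerLine a b hb n d α)),
      ℓ * f (t / ℓ) ∈ Set.Icc 0 (edges n d * (ℓ / 4)) := fun t ht => by
    obtain ⟨k, hk, θ, h0, h1, e⟩ := hsplit t ht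
    have h2 : (y (k + 1) : ℝ) ≤ (n * (4 * d + 20) : ℕ) := by
      rw [← hend]; exact_mod_cast hmono hk
    have h3 : (y k : ℝ) ≤ y (k + 1) := by exact_mod_cast hmono (Nat.le_succ k)
    have h4 : (0 : ℝ) ≤ y k := Nat.cast_nonneg _
    rw [e, hf, lin_natCast_add _ _ h0 h1, hed]
    constructor
    · have : 0 ≤ θ * ((y (k + 1) : ℝ) - y k) := mul_nonneg h0 (by linarith)
      positivity
    · have : θ * ((y (k + 1) : ℝ) - y k) ≤ y (k + 1) - y k :=
        mul_le_of_le_one_left (by linarith) h1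
      have h5 : (y k : ℝ) + θ * ((y (k + 1) : ℝ) - y k) ≤ (n * (4 * d + 20) : ℕ) := by linarith
      have := mul_le_mul_of_nonneg_left h5 hl.le
      linarith
  refine Polyline.barkingDistance_eq_zero (γ := fun t => ℓ * f (t / ℓ)) ⟨?_, ?_, ?_, ?_⟩ ?_
  · intro t ht
    rw [length_dogLine]
    exact hmaps t ht
  · have := lin_natCast (fun k => (y k : ℝ)) 0
    rw [Nat.cast_zero] at this
    show ℓ * f (0 / ℓ) = 0
    rw [zero_div, hf, this, hydef, dogWalk_zero, Nat.cast_zero, mul_zero]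
  · rw [length_hikerLine, length_dogLine, mul_div_cancel_right₀ _ hl.ne', hf, lin_natCast, hend,
      hed]
    ring
  · refine LipschitzOnWith.of_dist_le_mul fun s hs t ht => ?_
    rw [Real.dist_eq, Real.dist_eq, NNReal.coe_one, one_mul, ← mul_sub, abs_mul, abs_of_pos hl]
    have := hlip (s / ℓ) (t / ℓ) (div_nonneg hs.1 hl.le) (div_nonneg ht.1 hl.le)
    rw [← sub_div, abs_div, abs_of_pos hl] at this
    have h2 := mul_le_mul_of_nonneg_left this hl.le
    rwa [mul_div_cancel₀ _ hl.ne'] at h2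
  · intro t ht
    have hq := hmaps t ht
    obtain ⟨k, hk, θ, h0, h1, e⟩ := hsplit t ht
    rw [length_hikerLine] at ht
    have hrange : ∀ k, |hikerReal n d α k - (dogReal d β (y k) + 3)| ≤ 3 := fun k => by
      have := dogWalk_inRange hi hj hij k
      have h1 : ((dogLevel d β (y k) : ℕ) : ℝ) ≤ hikerLevel n d α k := by exact_mod_cast this.1
      have h2 : (hikerLevel n d α k : ℝ) ≤ (dogLevel d β (y k) + 6 : ℕ) := by
        exact_mod_cast this.2
      push_cast at h2
      unfold hikerReal dogReal
      rw [abs_le]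
      constructor <;> linarith
    -- The range condition is convex and holds at both ends of the step.
    have hx : |hikerReal n d α k + θ * (hikerReal n d α (k + 1) - hikerReal n d α k) -
        (dogReal d β (y k) + θ * (dogReal d β (y (k + 1)) - dogReal d β (y k)) + 3)| ≤ 3 := by
      have h2 := abs_le.1 (hrange k)
      have h3 := abs_le.1 (hrange (k + 1))
      rw [abs_le]
      constructor <;> nlinarith
    have hdx : |Polyline.point (hikerLine a b hb n d α) t 0 -
        Polyline.point (dogLine a b hb n d β) (ℓ * f (t / ℓ)) 0| ≤ 3 * (a / b) := by
      rw [hikerLine_zero hb α ha hn ht.1 ht.2, dogLine_zero hb β ha hn hq.1 hq.2, ← hℓ,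
        mul_div_cancel_left₀ _ hl.ne', e, hf, lin_comp_step _ _ _ (hstep k) h0 h1,
        lin_natCast_add _ _ h0 h1, ← mul_sub, abs_mul, abs_of_pos hu, mul_comm]
      exact mul_le_mul_of_nonneg_right hx hu.le
    -- The hiker's height is at most `u / 2` and the dog's depth at most `u / 8`.
    have hdy : |Polyline.point (hikerLine a b hb n d α) t 1 -
        Polyline.point (dogLine a b hb n d β) (ℓ * f (t / ℓ)) 1| ≤ 5 / 8 * (a / b) := by
      rw [hikerLine_one hb α ha hn ht.1 ht.2, dogLine_one hb β ha hn hq.1 hq.2, ← hℓ]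
      have hp0 : 0 ≤ t / ℓ := div_nonneg ht.1 hl.le
      have hp1 : t / ℓ ≤ edges n d := (div_le_iff₀ hl).2 ht.2
      have hq0 : 0 ≤ ℓ * f (t / ℓ) / (ℓ / 4) := div_nonneg hq.1 (by linarith)
      have hq1 : ℓ * f (t / ℓ) / (ℓ / 4) ≤ edges n d := (div_le_iff₀ (by linarith)).2 hq.2
      have hA : (0 : ℝ) < a / b / (2 * (edges n d + 1)) := by positivity
      have hB : (0 : ℝ) < a / b / (8 * (edges n d + 1)) := by positivity
      have hA' : (a / b / (2 * (edges n d + 1)) : ℝ) * (edges n d + 1) = a / b / 2 := by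
        field_simp
      have hB' : (a / b / (8 * (edges n d + 1)) : ℝ) * (edges n d + 1) = a / b / 8 := by
        field_simp
      have h2 := mul_le_mul_of_nonneg_left hp1 hA.le
      have h3 := mul_le_mul_of_nonneg_left hq1 hB.le
      have h4 := mul_nonneg hA.le hp0
      have h5 := mul_nonneg hB.le hq0
      rw [abs_le]
      constructor <;> linarith
    refine le_trans ?_ hρ
    rw [EuclideanSpace.dist_eq, Fin.sum_univ_two, Real.dist_eq, Real.dist_eq]
    refine Real.sqrt_le_iff.2 ⟨by positivity, ?_⟩
    have h2 := pow_le_pow_left₀ (abs_nonneg _) hdx 2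
    have h3 := pow_le_pow_left₀ (abs_nonneg _) hdy 2
    have h4 : (0 : ℝ) ≤ (a / b) ^ 2 := by positivity
    refine (add_le_add h2 h3).trans ?_
    -- Numerically, `3 ^ 2 + (5/8) ^ 2 ≤ (13/4) ^ 2`.
    nlinarith

end polylines

end BarkingReduction

/-! ### Expressions on the word RAM -/

namespace WordRAM

/-- The operation on natural numbers that `BinOp.eval` implements as long as nothing overflows. -/
def BinOp.exact : BinOp → ℕ → ℕ → ℕ
  | .add, a, b => a + b
  | .sub, a, b => a - b
  | .mul, a, b => a * b
  | .div, a, b => a / b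
  | .mod, a, b => a % b
  | .and, a, b => a &&& b
  | .or, a, b => a ||| b
  | .xor, a, b => a ^^^ b
  | .shl, a, b => a * 2 ^ b
  | .shr, a, b => a / 2 ^ b
  | .eq, a, b => if a = b then 1 else 0
  | .lt, a, b => if a < b then 1 else 0

/-- No overflow occurs modulo `W`. -/
def BinOp.Fits (W : ℕ) : BinOp → ℕ → ℕ → Prop
  | .add, a, b => a + b < W
  | .sub, a, b => b ≤ a ∧ a < W
  | .mul, a, b => a * b < W
  | .shl, a, b => a * 2 ^ b < W
  | _, _, _ => True

theorem BinOp.eval_eq_exact {w : ℕ} {o : BinOp} {a b : ℕ} (h : o.Fits (2 ^ w) a b) :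
    o.eval w a b = o.exact a b := by
  cases o
  case sub =>
    obtain ⟨h1, h2⟩ := h
    simp only [BinOp.eval, BinOp.exact]
    rw [Nat.mod_eq_of_lt (h1.trans_lt h2), show a + (2 ^ w - b) = a - b + 2 ^ w by omega,
      Nat.add_mod_right, Nat.mod_eq_of_lt (by omega)]
  all_goals first | rfl | exact Nat.mod_eq_of_lt h

/-- Expressions over registers and arrays. -/
inductive Expr where
  | lit (k : ℕ)
  | var (r : ℕ)
  | bin (o : BinOp) (e f : Expr)
  | fetch (m : ℕ) (e : Expr)
  | ite (c e f : Expr)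

namespace Expr

/-- The value of an expression, in exact arithmetic. -/
def val (s : State) : Expr → ℕ
  | lit k => k
  | var r => s.reg r
  | bin o e f => o.exact (e.val s) (f.val s)
  | fetch m e => s.mem m (e.val s)
  | ite c e f => if c.val s ≠ 0 then e.val s else f.val s

/-- No overflow occurs modulo `W` in the evaluation of an expression. -/
def Ok (W : ℕ) (s : State) : Expr → Prop
  | lit k => k < W
  | var _ => True
  | bin o e f => e.Ok W s ∧ f.Ok W s ∧ o.Fits W (e.val s) (f.val s)
  | fetch _ e => e.Ok W s
  | ite c e f => c.Ok W s ∧ (c.val s ≠ 0 → e.Ok W s) ∧ (c.val s = 0 → f.Ok W s)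

/-- All variables of the expression are below `r`. -/
def Below (r : ℕ) : Expr → Prop
  | lit _ => True
  | var q => q < r
  | bin _ e f => e.Below r ∧ f.Below r
  | fetch _ e => e.Below r
  | ite c e f => c.Below r ∧ e.Below r ∧ f.Below r

/-- The number of registers used by the evaluation of an expression. -/
def width : Expr → ℕ
  | lit _ => 1
  | var _ => 1
  | bin _ e f => max e.width (f.width + 1)
  | fetch _ e => e.width
  | ite c e f => max c.width (max e.width f.width)

/-- A bound for the time that the evaluation of an expression takes. -/
def cost : Expr → ℕ
  | lit _ => 1
  | var _ => 1
  | bin _ e f => e.cost + f.cost + 1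
  | fetch _ e => e.cost + 1
  | ite c e f => c.cost + (e.cost + f.cost + 1)

/-- A program that puts the value of an expression into register `r`. -/
def code : Expr → ℕ → Prog
  | lit k, r => .const r k
  -- A register is copied by taking its bitwise `or` with itself.
  | var q, r => .op .or r q q
  | bin o e f, r => .seq (.seq (e.code r) (f.code (r + 1))) (.op o r r (r + 1))
  | fetch m e, r => .seq (e.code r) (.load r m r)
  | ite c e f, r => .seq (c.code r) (.branch r (e.code r) (f.code r))

theorem width_pos (e : Expr) : 0 < e.width := by
  induction e <;> simp [width, *]

theorem Below.mono {e : Expr} {r r' : ℕ} (h : e.Below r) (hr : r ≤ r') : e.Below r' := by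
  induction e with
  | lit => trivial
  | var q => exact lt_of_lt_of_le h hr
  | bin o e f he hf => exact ⟨he h.1, hf h.2⟩
  | fetch m e he => exact he h
  | ite c e f hc he hf => exact ⟨hc h.1, he h.2.1, hf h.2.2⟩

theorem val_congr {s s' : State} {r : ℕ} (hreg : ∀ q < r, s'.reg q = s.reg q)
    (hmem : s'.mem = s.mem) {e : Expr} (h : e.Below r) : e.val s' = e.val s := by
  induction e with
  | lit => rfl
  | var q => exact hreg q h
  | bin o e f he hf => simp only [val, he h.1, hf h.2]
  | fetch m e he => simp only [val, he h, hmem]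
  | ite c e f hc he hf => simp only [val, hc h.1, he h.2.1, hf h.2.2]

theorem ok_congr {W : ℕ} {s s' : State} {r : ℕ} (hreg : ∀ q < r, s'.reg q = s.reg q)
    (hmem : s'.mem = s.mem) {e : Expr} (h : e.Below r) : e.Ok W s' ↔ e.Ok W s := by
  induction e with
  | lit => rfl
  | var q => rfl
  | bin o e f he hf =>
    simp only [Ok, he h.1, hf h.2, val_congr hreg hmem h.1, val_congr hreg hmem h.2]
  | fetch m e he => simp only [Ok, he h]
  | ite c e f hc he hf =>
    simp only [Ok, hc h.1, he h.2.1, hf h.2.2, val_congr hreg hmem h.1]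

/-- Registers are used as a stack: variables and pending intermediate values lie below `r`, scratch
space from `r` on. Hence evaluating one operand preserves the other. -/
theorem run_code {w : ℕ} (e : Expr) (r : ℕ) (s : State) (hok : e.Ok (2 ^ w) s)
    (hb : e.Below r) :
    ∃ t s', Run w (e.code r) s t s' ∧ t ≤ e.cost ∧ s'.reg r = e.val s ∧ s'.mem = s.mem ∧
      ∀ q, q < r ∨ r + e.width ≤ q → s'.reg q = s.reg q := by
  induction e generalizing r s with
  | lit k =>
    refine ⟨1, _, .const r k s, le_rfl, ?_, rfl, fun q hq => ?_⟩
    · simp [State.setReg, val, Nat.mod_eq_of_lt hok]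
    · simp only [width] at hq
      exact Function.update_of_ne (by omega) _ _
  | var q =>
    refine ⟨1, _, .op .or r q q s, le_rfl, ?_, rfl, fun q hq => ?_⟩
    · simp [State.setReg, val, BinOp.eval]
    · simp only [width] at hq
      exact Function.update_of_ne (by omega) _ _
  | bin o e f he hf =>
    obtain ⟨t1, s1, hr1, ht1, hv1, hm1, hq1⟩ := he r s hok.1 hb.1
    have hreg : ∀ q < r, s1.reg q = s.reg q := fun q hq => hq1 q (Or.inl hq)
    obtain ⟨t2, s2, hr2, ht2, hv2, hm2, hq2⟩ := hf (r + 1) s1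
      ((ok_congr hreg hm1 hb.2).2 hok.2.1) (hb.2.mono (Nat.le_succ r))
    refine ⟨_, _, .seq (.seq hr1 hr2) (.op o r r (r + 1) s2), ?_, ?_, ?_, fun q hq => ?_⟩
    · simp only [cost]; omega
    · simp only [State.setReg, Function.update_self, val]
      rw [hv2, hq2 r (Or.inl (Nat.lt_succ_self r)), hv1, val_congr hreg hm1 hb.2]
      exact BinOp.eval_eq_exact hok.2.2
    · exact hm2.trans hm1
    · simp only [width] at hq
      have := width_pos e
      have h1 : q ≠ r := by omega
      simp only [State.setReg]
      rw [Function.update_of_ne h1, hq2 q (by omega), hq1 q (by omega)]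
  | fetch m e he =>
    obtain ⟨t1, s1, hr1, ht1, hv1, hm1, hq1⟩ := he r s hok hb
    refine ⟨_, _, .seq hr1 (.load r m r s1), ?_, ?_, hm1, fun q hq => ?_⟩
    · simp only [cost]; omega
    · simp [State.setReg, val, hv1, hm1]
    · simp only [width] at hq
      have := width_pos e
      have h1 : q ≠ r := by omega
      simp only [State.setReg]
      rw [Function.update_of_ne h1, hq1 q hq]
  | ite c e f hc he hf =>
    obtain ⟨t1, s1, hr1, ht1, hv1, hm1, hq1⟩ := hc r s hok.1 hb.1
    have hreg : ∀ q < r, s1.reg q = s.reg q := fun q hq => hq1 q (Or.inl hq)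
    by_cases h : c.val s = 0
    · obtain ⟨t2, s2, hr2, ht2, hv2, hm2, hq2⟩ := hf r s1
        ((ok_congr hreg hm1 hb.2.2).2 (hok.2.2 h)) hb.2.2
      refine ⟨_, _, .seq hr1 (.branch_false (hv1.trans h) hr2), ?_, ?_, hm2.trans hm1,
        fun q hq => ?_⟩
      · simp only [cost]; omega
      · simp [val, h, hv2, val_congr hreg hm1 hb.2.2]
      · simp only [width] at hq
        rw [hq2 q (by omega), hq1 q (by omega)]
    · obtain ⟨t2, s2, hr2, ht2, hv2, hm2, hq2⟩ := he r s1
        ((ok_congr hreg hm1 hb.2.1).2 (hok.2.1 h)) hb.2.1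
      refine ⟨_, _, .seq hr1 (.branch_true (by rwa [hv1]) hr2), ?_, ?_, hm2.trans hm1,
        fun q hq => ?_⟩
      · simp only [cost]; omega
      · simp [val, h, hv2, val_congr hreg hm1 hb.2.1]
      · simp only [width] at hq
        rw [hq2 q (by omega), hq1 q (by omega)]

end Expr

/-! ### Programs with workspace -/

/-- The state agrees with the given one up to the workspace, the registers from `20` to `99`. -/
def Agrees (σ s : State) : Prop :=
  (∀ q, q < 20 ∨ 100 ≤ q → s.reg q = σ.reg q) ∧ s.mem = σ.mem

/-- Started in a state with `S`, the program halts within `C` steps in a state with `S'`. -/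
def Reaches (w : ℕ) (p : Prog) (C : ℕ) (S S' : State → Prop) : Prop :=
  ∀ s, S s → ∃ t s', Run w p s t s' ∧ t ≤ C ∧ S' s'

theorem Reaches.seq {w : ℕ} {p q : Prog} {C D : ℕ} {S S' S'' : State → Prop}
    (hp : Reaches w p C S S') (hq : Reaches w q D S' S'') :
    Reaches w (.seq p q) (C + D) S S'' := by
  intro s hs
  obtain ⟨t, s', hr, ht, hs'⟩ := hp s hs
  obtain ⟨t', s'', hr', ht', hs''⟩ := hq s' hs'
  exact ⟨_, _, .seq hr hr', by omega, hs''⟩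

theorem Reaches.loop {w : ℕ} {p : Prog} {C a N : ℕ} {I : ℕ → State → Prop}
    (hstep : ∀ i < N, Reaches w p C (I i) (I (i + 1)))
    (hne : ∀ i < N, ∀ s, I i s → s.reg a ≠ 0) (hend : ∀ s, I N s → s.reg a = 0) :
    Reaches w (.loop a p) (N * (C + 1) + 1) (I 0) (I N) := by
  suffices h : ∀ e i, i + e = N → Reaches w (.loop a p) (e * (C + 1) + 1) (I i) (I N) from
    h N 0 (by omega)
  intro e
  induction e with
  | zero =>
    intro i hi s hs
    have : i = N := by omega
    subst this
    exact ⟨1, s, .loop_done (hend s hs), by omega, hs⟩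
  | succ e ih =>
    intro i hi s hs
    obtain ⟨t, s', hr, ht, hs'⟩ := hstep i (by omega) s hs
    obtain ⟨t', s'', hr', ht', hs''⟩ := ih (i + 1) (by omega) s' hs'
    refine ⟨_, _, .loop_step (hne i (by omega) s hs) hr hr', ?_, hs''⟩
    rw [add_mul, one_mul]
    omega

/-- Assign the value of an expression to a register. -/
def assign (r : ℕ) (e : Expr) : Prog := .seq (e.code 20) (.op .or r 20 20)

/-- Write the value of an expression to an array. -/
def put (m : ℕ) (a e : Expr) : Prog := .seq (.seq (a.code 20) (e.code 21)) (.store m 20 21)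

/-- Program variables occupy registers below 20, so specifications can speak of an idealised state
and ignore the scratch registers. -/
theorem reaches_assign {w r : ℕ} {e : Expr} {σ : State} (hok : e.Ok (2 ^ w) σ)
    (hb : e.Below 20) (hw : e.width ≤ 80) (hr : r < 20) :
    Reaches w (assign r e) (e.cost + 1) (Agrees σ) (Agrees (σ.setReg r (e.val σ))) := by
  intro s hs
  have hreg : ∀ q < 20, s.reg q = σ.reg q := fun q hq => hs.1 q (Or.inl hq)
  obtain ⟨t, s', h1, h2, h3, h4, h5⟩ := e.run_code 20 s ((Expr.ok_congr hreg hs.2 hb).2 hok) hb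
  refine ⟨_, _, .seq h1 (.op .or r 20 20 s'), by omega, fun q hq => ?_, h4.trans hs.2⟩
  simp only [State.setReg, BinOp.eval, Nat.or_self, h3, Expr.val_congr hreg hs.2 hb]
  by_cases h : q = r
  · subst h; simp
  · rw [Function.update_of_ne h, Function.update_of_ne h, h5 q (by omega), hs.1 q hq]

theorem reaches_put {w m : ℕ} {a e : Expr} {σ : State} (hoka : a.Ok (2 ^ w) σ)
    (hoke : e.Ok (2 ^ w) σ) (hba : a.Below 20) (hbe : e.Below 20) (hwa : a.width ≤ 80)
    (hwe : e.width ≤ 79) :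
    Reaches w (put m a e) (a.cost + e.cost + 1) (Agrees σ)
      (Agrees (σ.setMem m (a.val σ) (e.val σ))) := by
  intro s hs
  have hreg : ∀ q < 20, s.reg q = σ.reg q := fun q hq => hs.1 q (Or.inl hq)
  obtain ⟨t, s', h1, h2, h3, h4, h5⟩ := a.run_code 20 s ((Expr.ok_congr hreg hs.2 hba).2 hoka) hba
  have hreg' : ∀ q < 20, s'.reg q = σ.reg q := fun q hq => (h5 q (Or.inl hq)).trans (hreg q hq)
  have hmem' := h4.trans hs.2
  obtain ⟨t', s'', h1', h2', h3', h4', h5'⟩ := e.run_code 21 s'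
    ((Expr.ok_congr hreg' hmem' hbe).2 hoke) (hbe.mono (by omega))
  refine ⟨_, _, .seq (.seq h1 h1') (.store m 20 21 s''), by omega, fun q hq => ?_, ?_⟩
  · simp only [State.setMem]
    rw [h5' q (by omega), h5 q (by omega), hs.1 q hq]
  · simp only [State.setMem]
    rw [h3', h5' 20 (by omega), h3, h4', hmem', Expr.val_congr hreg' hmem' hbe,
      Expr.val_congr hreg hs.2 hba]

/-! ### Running a program in a fresh part of the memory -/

/-- The program with all registers and all arrays renamed by a shift. -/
def Prog.shift (R : ℕ) : Prog → Prog
  | .const r k => .const (r + R) k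
  | .op o r a b => .op o (r + R) (a + R) (b + R)
  | .load r m a => .load (r + R) (m + 1) (a + R)
  | .store m a b => .store (m + 1) (a + R) (b + R)
  | .seq p q => .seq (p.shift R) (q.shift R)
  | .branch a p q => .branch (a + R) (p.shift R) (q.shift R)
  | .loop a p => .loop (a + R) (p.shift R)

/-- A lockstep simulation. Registers below `R` and array 0 are never accessed, so whatever an
earlier program left there is harmless. -/
theorem Run.shift {w R : ℕ} {p : Prog} {s s' : State} {t : ℕ} (h : Run w p s t s') {σ : State}
    (hreg : ∀ r, σ.reg (r + R) = s.reg r) (hmem : ∀ m, σ.mem (m + 1) = s.mem m) :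
    ∃ σ', Run w (p.shift R) σ t σ' ∧ (∀ r, σ'.reg (r + R) = s'.reg r) ∧
      ∀ m, σ'.mem (m + 1) = s'.mem m := by
  have hset : ∀ (σ s : State) (r v : ℕ), (∀ r, σ.reg (r + R) = s.reg r) →
      ∀ q, (σ.setReg (r + R) v).reg (q + R) = (s.setReg r v).reg q := by
    intro σ s r v h q
    by_cases hq : q = r
    · subst hq; simp [State.setReg]
    · simp only [State.setReg]
      rw [Function.update_of_ne hq, Function.update_of_ne (by omega), h]
  induction h generalizing σ with
  | const r k s =>
    exact ⟨_, .const _ _ _, hset _ _ _ _ hreg, hmem⟩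
  | op o r a b s =>
    refine ⟨_, .op _ _ _ _ _, ?_, hmem⟩
    rw [hreg, hreg]
    exact hset _ _ _ _ hreg
  | load r m a s =>
    refine ⟨_, .load _ _ _ _, ?_, hmem⟩
    rw [hreg, hmem]
    exact hset _ _ _ _ hreg
  | store m a b s =>
    refine ⟨_, .store _ _ _ _, hreg, fun q => ?_⟩
    simp only [State.setMem]
    rw [hreg, hreg, hmem]
    by_cases hq : q = m
    · subst hq; simp
    · rw [Function.update_of_ne hq, Function.update_of_ne (by omega), hmem]
  | seq _ _ ih1 ih2 =>
    obtain ⟨σ1, h1, h2, h3⟩ := ih1 hreg hmem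
    obtain ⟨σ2, h4, h5, h6⟩ := ih2 h2 h3
    exact ⟨_, .seq h1 h4, h5, h6⟩
  | branch_true ha _ ih =>
    obtain ⟨σ1, h1, h2, h3⟩ := ih hreg hmem
    exact ⟨_, .branch_true (by rwa [hreg]) h1, h2, h3⟩
  | branch_false ha _ ih =>
    obtain ⟨σ1, h1, h2, h3⟩ := ih hreg hmem
    exact ⟨_, .branch_false (by rwa [hreg]) h1, h2, h3⟩
  | loop_done ha => exact ⟨_, .loop_done (by rwa [hreg]), hreg, hmem⟩
  | loop_step ha _ _ ih1 ih2 =>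
    obtain ⟨σ1, h1, h2, h3⟩ := ih1 hreg hmem
    obtain ⟨σ2, h4, h5, h6⟩ := ih2 h2 h3
    exact ⟨_, .loop_step (by rwa [hreg]) h1 h4, h5, h6⟩

end WordRAM

/-! ### The program of the reduction -/

namespace WordRAM.Expr

/-- Sum of expressions. -/
def plus (e f : Expr) : Expr := .bin .add e f

/-- Difference of expressions. -/
def minus (e f : Expr) : Expr := .bin .sub e f

/-- Product of expressions. -/
def times (e f : Expr) : Expr := .bin .mul e f

/-- Quotient of expressions. -/
def quot (e f : Expr) : Expr := .bin .div e f

/-- Remainder of expressions. -/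
def rem (e f : Expr) : Expr := .bin .mod e f

/-- If `e < f` then `g` else `h`. -/
def ifLt (e f g h : Expr) : Expr := .ite (.bin .lt e f) g h

/-- If `e = f` then `g` else `h`. -/
def ifEq (e f g h : Expr) : Expr := .ite (.bin .eq e f) g h

/-- If `e ≤ f` then `g` else `h`. -/
def ifLe (e f g h : Expr) : Expr := ifLt e (plus f (lit 1)) g h

section

variable (e f g h : Expr) (s : State) (W r : ℕ)

theorem val_lit (k : ℕ) : (lit k).val s = k := rfl
theorem val_var : (var r).val s = s.reg r := rfl
theorem val_fetch (m : ℕ) : (fetch m e).val s = s.mem m (e.val s) := rfl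
theorem val_plus : (plus e f).val s = e.val s + f.val s := rfl
theorem val_minus : (minus e f).val s = e.val s - f.val s := rfl
theorem val_times : (times e f).val s = e.val s * f.val s := rfl
theorem val_quot : (quot e f).val s = e.val s / f.val s := rfl
theorem val_rem : (rem e f).val s = e.val s % f.val s := rfl

theorem val_ifLt : (ifLt e f g h).val s = if e.val s < f.val s then g.val s else h.val s := by
  simp [ifLt, val, BinOp.exact]

theorem val_ifEq : (ifEq e f g h).val s = if e.val s = f.val s then g.val s else h.val s := by
  simp [ifEq, val, BinOp.exact]

theorem val_ifLe : (ifLe e f g h).val s = if e.val s ≤ f.val s then g.val s else h.val s := by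
  simp [ifLe, val_ifLt, val_plus, val_lit]

theorem ok_lit (k : ℕ) : (lit k).Ok W s ↔ k < W := Iff.rfl
theorem ok_var : (var r).Ok W s ↔ True := Iff.rfl
theorem ok_fetch (m : ℕ) : (fetch m e).Ok W s ↔ e.Ok W s := Iff.rfl
theorem ok_plus : (plus e f).Ok W s ↔ e.Ok W s ∧ f.Ok W s ∧ e.val s + f.val s < W := Iff.rfl
theorem ok_minus :
    (minus e f).Ok W s ↔ e.Ok W s ∧ f.Ok W s ∧ f.val s ≤ e.val s ∧ e.val s < W := Iff.rfl
theorem ok_times : (times e f).Ok W s ↔ e.Ok W s ∧ f.Ok W s ∧ e.val s * f.val s < W := Iff.rfl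

theorem ok_quot : (quot e f).Ok W s ↔ e.Ok W s ∧ f.Ok W s := by
  simp [quot, Ok, BinOp.Fits]

theorem ok_rem : (rem e f).Ok W s ↔ e.Ok W s ∧ f.Ok W s := by
  simp [rem, Ok, BinOp.Fits]

theorem ok_ifLt : (ifLt e f g h).Ok W s ↔ e.Ok W s ∧ f.Ok W s ∧
    (e.val s < f.val s → g.Ok W s) ∧ (¬ e.val s < f.val s → h.Ok W s) := by
  simp [ifLt, Ok, BinOp.Fits, val, BinOp.exact, and_assoc]

theorem ok_ifEq : (ifEq e f g h).Ok W s ↔ e.Ok W s ∧ f.Ok W s ∧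
    (e.val s = f.val s → g.Ok W s) ∧ (¬ e.val s = f.val s → h.Ok W s) := by
  simp [ifEq, Ok, BinOp.Fits, val, BinOp.exact, and_assoc]

theorem ok_ifLe : (ifLe e f g h).Ok W s ↔ e.Ok W s ∧ (f.Ok W s ∧ 1 < W ∧ f.val s + 1 < W) ∧
    (e.val s ≤ f.val s → g.Ok W s) ∧ (¬ e.val s ≤ f.val s → h.Ok W s) := by
  simp only [ifLe, ok_ifLt, ok_plus, val_plus, val_lit, ok_lit, Nat.lt_succ_iff]

end

end WordRAM.Expr

namespace BarkingReduction

open WordRAM WordRAM.Expr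

/-- The profile of one coordinate. -/
def waveExpr (r t : Expr) : Expr := ifEq r (lit 2) (times (lit 2) t) (rem r (lit 2))

/-- The entry in column `o / 4` of row `i` of the matrix stored from position `p` on. -/
def bitExpr (p i o : Expr) : Expr := fetch 0 (plus p (plus (times i (var 2)) (quot o (lit 4))))

/-- The level of the hiker at the time in register `7`. -/
def hikerExpr : Expr :=
  let q := minus (var 7) (plus (var 3) (lit 6))
  let g := plus (times (lit 4) (var 2)) (lit 2)
  ifLe (var 7) (var 3) (plus (lit 5) (rem (var 7) (lit 2))) <|
  ifLe (var 7) (plus (var 3) (lit 5)) (minus (plus (var 3) (lit 5)) (var 7)) <|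
  ifLe (var 7) (var 5)
    (plus (lit 1) (ifEq (rem q g) (lit 0) (lit 0) (plus (lit 1)
      (waveExpr (rem (minus (rem q g) (lit 1)) (lit 4))
        (minus (lit 1) (bitExpr (lit 2) (quot q g) (minus (rem q g) (lit 1)))))))) <|
  ifLe (var 7) (plus (var 5) (lit 10)) (plus (lit 1) (minus (var 7) (var 5))) <|
  ifLe (var 7) (plus (var 5) (lit 16)) (minus (plus (var 5) (lit 21)) (var 7)) <|
  plus (lit 5) (rem (var 7) (lit 2))

/-- The level of the dog's polyline at position `m`. -/
def dogExpr (m : Expr) : Expr :=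
  let D := fun k => plus (times (lit 4) (var 2)) (lit k)
  let o := rem m (D 20)
  ifLe o (lit 1) o <|
  ifLe o (D 2) (plus (lit 2) (waveExpr (rem (minus o (lit 2)) (lit 4))
    (bitExpr (plus (lit 2) (times (var 1) (var 2))) (quot m (D 20)) (minus o (lit 2))))) <|
  ifLe o (D 3) (lit 1) <|
  ifLe o (D 7) (minus o (D 2)) <|
  ifLe o (D 10) (minus (D 12) o) <|
  ifLe o (D 18) (plus (lit 2) (rem o (lit 2))) <|
  lit 1

/-- The level of the vertex in register `7` of the dog's polyline, in quarters. -/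
def quarterExpr : Expr :=
  plus (times (minus (lit 4) (rem (var 7) (lit 4))) (dogExpr (quot (var 7) (lit 4))))
    (times (rem (var 7) (lit 4)) (dogExpr (plus (quot (var 7) (lit 4)) (lit 1))))

/-- The matrix of bits stored in the word list `x` from position `p` on. -/
def rowBits (x : List ℕ) (d p i c : ℕ) : Bool := decide (x.getD (p + (i * d + c)) 0 = 1)

theorem toNat_rowBits {x : List ℕ} (hx : ∀ i, 2 ≤ i → x.getD i 0 ≤ 1) (d : ℕ) {p : ℕ}
    (hp : 2 ≤ p) (i c : ℕ) : (rowBits x d p i c).toNat = x.getD (p + (i * d + c)) 0 := by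
  have := hx (p + (i * d + c)) (by omega)
  unfold rowBits
  by_cases h : x.getD (p + (i * d + c)) 0 = 1
  · rw [h]; rfl
  · rw [decide_eq_false h, Bool.toNat_false]; omega

/-- The state of the program in its main loop, with `out` in the output array. -/
def loopState (x : List ℕ) (n d : ℕ) (out : ℕ → ℕ) (v k c X : ℕ) : State where
  reg := fun q => if q = 1 then n else if q = 2 then d else if q = 3 then n * (4 * d + 20)
    else if q = 4 then edges n d + 1 else if q = 5 then climbTime n d else if q = 6 then v
    else if q = 7 then k else if q = 8 then c else if q = 9 then X else 0
  mem := fun m i => if m = 0 then x.getD i 0 else if m = 1 then out i else 0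

section values

variable {x : List ℕ} {n d : ℕ} {out : ℕ → ℕ} {v k c X W : ℕ}

theorem loopState_reg :
    (loopState x n d out v k c X).reg 1 = n ∧ (loopState x n d out v k c X).reg 2 = d ∧
    (loopState x n d out v k c X).reg 3 = n * (4 * d + 20) ∧
    (loopState x n d out v k c X).reg 4 = edges n d + 1 ∧
    (loopState x n d out v k c X).reg 5 = climbTime n d ∧
    (loopState x n d out v k c X).reg 6 = v ∧ (loopState x n d out v k c X).reg 7 = k ∧
    (loopState x n d out v k c X).reg 8 = c ∧ (loopState x n d out v k c X).reg 9 = X :=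
  ⟨rfl, rfl, rfl, rfl, rfl, rfl, rfl, rfl, rfl⟩

theorem loopState_mem (i : ℕ) : (loopState x n d out v k c X).mem 0 i = x.getD i 0 := rfl

/-- The expression mirrors the definition of `hikerLevel` branch by branch, with Boolean negation as
`1 - bit`. -/
theorem val_hikerExpr (hx : ∀ i, 2 ≤ i → x.getD i 0 ≤ 1) :
    hikerExpr.val (loopState x n d out v k c X) = hikerLevel n d (rowBits x d 2) k := by
  simp only [hikerExpr, waveExpr, bitExpr, val_ifLe, val_ifEq, val_plus, val_minus, val_times,
    val_quot, val_rem, val_lit, val_var, val_fetch]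
  simp only [loopState, hikerLevel, hikerGadget, wave]
  have h : ∀ b : Bool, (!b).toNat = 1 - b.toNat := by decide
  simp only [h, toNat_rowBits hx d le_rfl]
  rfl

theorem val_dogExpr (hx : ∀ i, 2 ≤ i → x.getD i 0 ≤ 1) (m : Expr) :
    (dogExpr m).val (loopState x n d out v k c X) =
      dogLevel d (rowBits x d (2 + n * d)) (m.val (loopState x n d out v k c X)) := by
  simp only [dogExpr, waveExpr, bitExpr, val_ifLe, val_ifEq, val_plus, val_minus, val_times,
    val_quot, val_rem, val_lit, val_var, val_fetch]
  simp only [dogLevel, dogBlock, wave, toNat_rowBits hx d (Nat.le_add_right 2 (n * d))]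
  rfl

theorem val_quarterExpr (hx : ∀ i, 2 ≤ i → x.getD i 0 ≤ 1) :
    quarterExpr.val (loopState x n d out v k c X) =
      dogQuarter d (rowBits x d (2 + n * d)) k := by
  simp only [quarterExpr, val_plus, val_minus, val_times, val_quot, val_rem, val_lit, val_var,
    val_dogExpr hx]
  rfl

theorem ok_hikerExpr (hx : ∀ i, 2 ≤ i → x.getD i 0 ≤ 1) (hW : 4 * climbTime n d + 100 < W)
    (hd : 4 * d + 2 < W) (hk : 4 * k < W) :
    hikerExpr.Ok W (loopState x n d out v k c X) := by
  have h1 : n * (4 * d + 20) ≤ climbTime n d := by unfold climbTime; omega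
  have h2 := Nat.div_mul_le_self (k - (n * (4 * d + 20) + 6)) (4 * d + 2)
  -- The address contains the row index times `d`, which is bounded by replacing `d` by the gadget
  -- length and then using that quotient times divisor is at most the dividend.
  have h3 : (k - (n * (4 * d + 20) + 6)) / (4 * d + 2) * d ≤
      (k - (n * (4 * d + 20) + 6)) / (4 * d + 2) * (4 * d + 2) :=
    Nat.mul_le_mul_left _ (by omega)
  have h4 := Nat.mod_le (k - (n * (4 * d + 20) + 6)) (4 * d + 2)
  have hb := hx (2 + ((k - (n * (4 * d + 20) + 6)) / (4 * d + 2) * d +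
    ((k - (n * (4 * d + 20) + 6)) % (4 * d + 2) - 1) / 4)) (by omega)
  simp only [hikerExpr, waveExpr, bitExpr, ok_ifLe, ok_ifEq, ok_plus, ok_minus, ok_times,
    ok_quot, ok_rem, ok_lit, ok_var, ok_fetch, val_ifEq, val_plus, val_minus, val_times,
    val_quot, val_rem, val_lit, val_var, val_fetch, loopState_reg, loopState_mem]
  repeat' first | apply And.intro | intro _
  all_goals first | exact trivial | omega | (split_ifs <;> omega)

theorem ok_dogExpr (hx : ∀ i, 2 ≤ i → x.getD i 0 ≤ 1) (hd : 4 * d + 100 < W) {m : Expr}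
    (hm : m.Ok W (loopState x n d out v k c X))
    (hmW : n * d + 4 * m.val (loopState x n d out v k c X) + 100 < W) :
    (dogExpr m).Ok W (loopState x n d out v k c X) := by
  generalize hmv : m.val (loopState x n d out v k c X) = y at hmW
  have h2 := Nat.div_mul_le_self y (4 * d + 20)
  have h3 : y / (4 * d + 20) * d ≤ y / (4 * d + 20) * (4 * d + 20) :=
    Nat.mul_le_mul_left _ (by omega)
  have h4 := Nat.mod_le y (4 * d + 20)
  have hb := hx (2 + n * d + (y / (4 * d + 20) * d + (y % (4 * d + 20) - 2) / 4)) (by omega)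
  simp only [dogExpr, waveExpr, bitExpr, ok_ifLe, ok_ifEq, ok_plus, ok_minus, ok_times,
    ok_quot, ok_rem, ok_lit, ok_var, ok_fetch, val_ifEq, val_plus, val_minus, val_times,
    val_quot, val_rem, val_lit, val_var, val_fetch, loopState_reg, loopState_mem, hmv]
  repeat' first | apply And.intro | intro _
  all_goals first | exact trivial | exact hm | omega | (split_ifs <;> omega)

theorem dogQuarter_le (β : ℕ → ℕ → Bool) (i : ℕ) : dogQuarter d β i ≤ 20 := by
  unfold dogQuarter
  have h1 := Nat.mul_le_mul_left (4 - i % 4) (dogLevel_le d β (i / 4))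
  have h2 := Nat.mul_le_mul_left (i % 4) (dogLevel_le d β (i / 4 + 1))
  omega

theorem ok_quarterExpr (hx : ∀ i, 2 ≤ i → x.getD i 0 ≤ 1) (hd : 4 * d + 100 < W)
    (hW : n * d + k + 104 < W) : quarterExpr.Ok W (loopState x n d out v k c X) := by
  have h0 := dogQuarter_le (d := d) (rowBits x d (2 + n * d)) k
  unfold dogQuarter at h0
  have h1 : (quot (var 7) (lit 4)).Ok W (loopState x n d out v k c X) := by
    simp only [ok_quot, ok_var, ok_lit, true_and]; omega
  have h2 : (plus (quot (var 7) (lit 4)) (lit 1)).Ok W (loopState x n d out v k c X) := by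
    refine ⟨h1, ?_, ?_⟩
    · show 1 < W
      omega
    · show k / 4 + 1 < W
      omega
  have h3 := ok_dogExpr hx hd h1 (by
    simp only [val_quot, val_var, val_lit, loopState_reg]; omega)
  have h4 := ok_dogExpr hx hd h2 (by
    simp only [val_plus, val_quot, val_var, val_lit, loopState_reg]; omega)
  simp only [quarterExpr, ok_plus, ok_minus, ok_times, ok_rem, ok_lit, ok_var, val_plus, val_minus,
    val_times, val_dogExpr hx, val_quot, val_rem, val_lit, val_var, loopState_reg, h3, h4]
  repeat' first | apply And.intro | intro _
  all_goals first | exact trivial | omega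

end values

end BarkingReduction

/-! ### Writing the constructed instance to the output array -/

namespace BarkingReduction

open WordRAM WordRAM.Expr

/-- The index of the current vertex on its polyline. -/
def indexExpr : Expr := ifLt (var 6) (var 4) (var 6) (minus (var 6) (var 4))

/-- The level of the current vertex. -/
def levelExpr : Expr := ifLt (var 6) (var 4) hikerExpr (plus quarterExpr (lit 12))

/-- The words of the current vertex. -/
def wordExpr (a b : ℕ) : ℕ → Expr
  | 0 => lit 0
  | 1 => times (times (ifLt (var 6) (var 4) (lit (a * 8)) (lit (a * 2))) (var 4)) (var 9)
  | 2 => ifLt (var 6) (var 4) (lit 0) (lit 1)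
  | 3 => times (ifLt (var 6) (var 4) (lit (a * 4)) (lit a)) (plus (var 7) (lit 1))
  | _ => times (lit (b * 8)) (var 4)

/-- Write one word of the current vertex to the output array. -/
def putWord (a b c : ℕ) : Prog :=
  put 1 (plus (times (lit 5) (var 6)) (lit (1 + c))) (wordExpr a b c)

/-- Write the current vertex to the output array and go to the next one. -/
def body (a b : ℕ) : Prog :=
  .seq (assign 7 indexExpr) <| .seq (assign 9 levelExpr) <| .seq (putWord a b 0) <|
  .seq (putWord a b 1) <| .seq (putWord a b 2) <| .seq (putWord a b 3) <|
  .seq (putWord a b 4) <| .seq (assign 6 (plus (var 6) (lit 1)))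
    (assign 8 (ifLt (var 6) (times (lit 2) (var 4)) (lit 1) (lit 0)))

/-- Set up the registers. -/
def setup : Prog :=
  .seq (assign 1 (fetch 0 (lit 0))) <| .seq (assign 2 (fetch 0 (lit 1))) <|
  .seq (assign 3 (times (var 1) (plus (times (lit 4) (var 2)) (lit 20)))) <|
  .seq (assign 4 (plus (times (lit 4) (var 3)) (lit 1))) <|
  .seq (assign 5 (plus (plus (var 3) (lit 6))
    (times (var 1) (plus (times (lit 4) (var 2)) (lit 2))))) <|
  .seq (assign 8 (lit 1)) (put 1 (lit 0) (var 4))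

/-- The words of the vertices, those of the hiker's polyline first. -/
def vertexWord (a b n d : ℕ) (α β : ℕ → ℕ → Bool) (v : ℕ) : ℕ → ℕ
  | 0 => 0
  | 1 => if v < edges n d + 1 then a * 8 * (edges n d + 1) * hikerLevel n d α v
    else a * 2 * (edges n d + 1) * (dogQuarter d β (v - (edges n d + 1)) + 12)
  | 2 => if v < edges n d + 1 then 0 else 1
  | 3 => if v < edges n d + 1 then a * 4 * (v + 1) else a * (v - (edges n d + 1) + 1)
  | _ => b * 8 * (edges n d + 1)

/-- The initial segment of length `L` of a sequence, continued by zeros. -/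
def upTo (t : ℕ → ℕ) (L : ℕ) : ℕ → ℕ := fun i => if i < L then t i else 0

/-- Output words are written in increasing order of position, so the output array is always a prefix
of the intended word list. -/
theorem update_upTo (t : ℕ → ℕ) (L : ℕ) : Function.update (upTo t L) L (t L) = upTo t (L + 1) := by
  funext i
  by_cases h : i = L
  · subst h; simp [upTo]
  · rw [Function.update_of_ne h]
    simp only [upTo]
    congr 1
    exact propext (by omega)

section

variable {x : List ℕ} {n d : ℕ} {out : ℕ → ℕ} {v k c X W : ℕ}

theorem loopState_setMem (i y : ℕ) : (loopState x n d out v k c X).setMem 1 i y =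
    loopState x n d (Function.update out i y) v k c X := by
  unfold loopState State.setMem
  congr 1
  funext m
  by_cases h : m = 1
  · subst h
    rw [Function.update_self]
    funext j
    by_cases hj : j = i
    · subst hj; simp
    · simp [Function.update_of_ne hj]
  · rw [Function.update_of_ne h]; simp [h]

theorem loopState_setReg_six (y : ℕ) : (loopState x n d out v k c X).setReg 6 y =
    loopState x n d out y k c X := by
  unfold loopState State.setReg
  congr 1
  funext q
  simp only [Function.update_apply]
  split_ifs <;> first | rfl | omega

theorem loopState_setReg_seven (y : ℕ) : (loopState x n d out v k c X).setReg 7 y =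
    loopState x n d out v y c X := by
  unfold loopState State.setReg
  congr 1
  funext q
  simp only [Function.update_apply]
  split_ifs <;> first | rfl | omega

theorem loopState_setReg_eight (y : ℕ) : (loopState x n d out v k c X).setReg 8 y =
    loopState x n d out v k y X := by
  unfold loopState State.setReg
  congr 1
  funext q
  simp only [Function.update_apply]
  split_ifs <;> first | rfl | omega

theorem loopState_setReg_nine (y : ℕ) : (loopState x n d out v k c X).setReg 9 y =
    loopState x n d out v k c y := by
  unfold loopState State.setReg
  congr 1
  funext q
  simp only [Function.update_apply]
  split_ifs <;> first | rfl | omega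

/-- The words of the machine are large enough for the reduction. -/
def Fits (a b n d W : ℕ) : Prop :=
  100 * (a * (edges n d + 1)) + 100 * (b * (edges n d + 1)) + 100 * (edges n d + 1) + 100 * a +
    100 * b + 1000 < W

theorem size_bounds (hn : 1 ≤ n) : n * d + 4 * d + 20 ≤ edges n d ∧
    2 * climbTime n d ≤ edges n d + 12 ∧ n ≤ edges n d := by
  unfold edges climbTime
  have h1 : 4 * d + 20 ≤ n * (4 * d + 20) := Nat.le_mul_of_pos_left _ hn
  have h2 : n * (4 * d + 20) = 4 * (n * d) + 20 * n := by ring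
  have h3 : n * (4 * d + 2) = 4 * (n * d) + 2 * n := by ring
  omega

/-- The index of vertex number `v` on its polyline. -/
def vertexIndex (n d v : ℕ) : ℕ := if v < edges n d + 1 then v else v - (edges n d + 1)

/-- The level of vertex number `v`. -/
def vertexLevel (n d : ℕ) (α β : ℕ → ℕ → Bool) (v : ℕ) : ℕ :=
  if v < edges n d + 1 then hikerLevel n d α v else dogQuarter d β (v - (edges n d + 1)) + 12

/-- Two bounds are needed because levels are multiplied by `8 * a` for the hiker and `2 * a` for the
dog; the products get constants 88 and 64, below the 100 of `Fits`. -/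
theorem vertexLevel_le (α β : ℕ → ℕ → Bool) :
    (v < edges n d + 1 → vertexLevel n d α β v ≤ 11) ∧ vertexLevel n d α β v ≤ 32 := by
  have h1 := hikerLevel_le n d α v
  have h2 := dogQuarter_le (d := d) β (v - (edges n d + 1))
  unfold vertexLevel
  refine ⟨fun _ => ?_, ?_⟩ <;> split_ifs <;> omega

theorem val_levelExpr (hx : ∀ i, 2 ≤ i → x.getD i 0 ≤ 1) :
    levelExpr.val (loopState x n d out v (vertexIndex n d v) c X) =
      vertexLevel n d (rowBits x d 2) (rowBits x d (2 + n * d)) v := by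
  simp only [levelExpr, val_ifLt, val_hikerExpr hx, val_plus, val_quarterExpr hx, val_var, val_lit,
    loopState_reg, vertexIndex, vertexLevel]
  split_ifs <;> rfl

theorem ok_levelExpr {a b : ℕ} (hx : ∀ i, 2 ≤ i → x.getD i 0 ≤ 1) (hn : 1 ≤ n)
    (hW : Fits a b n d W) (hk : k ≤ edges n d) :
    levelExpr.Ok W (loopState x n d out v k c X) := by
  have h1 := size_bounds (d := d) hn
  unfold Fits at hW
  have h2 := dogQuarter_le (d := d) (rowBits x d (2 + n * d)) k
  simp only [levelExpr, ok_ifLt, ok_plus, ok_var, ok_lit, val_quarterExpr hx, val_lit,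
    ok_hikerExpr hx (show 4 * climbTime n d + 100 < W by omega) (show 4 * d + 2 < W by omega)
      (show 4 * k < W by omega),
    ok_quarterExpr hx (show 4 * d + 100 < W by omega) (show n * d + k + 104 < W by omega)]
  refine ⟨trivial, trivial, fun _ => trivial, fun _ => ⟨trivial, ?_, ?_⟩⟩ <;> omega

theorem val_wordExpr (a b : ℕ) (α β : ℕ → ℕ → Bool) (e : ℕ) :
    (wordExpr a b e).val (loopState x n d out v (vertexIndex n d v) c (vertexLevel n d α β v)) =
      vertexWord a b n d α β v e := by
  rcases e with _ | _ | _ | _ | e <;>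
  simp only [wordExpr, vertexWord, val_times, val_ifLt, val_lit, val_var, val_plus,
    loopState_reg, vertexIndex, vertexLevel] <;> split_ifs <;> rfl

theorem ok_wordExpr {a b : ℕ} (hW : Fits a b n d W) (hk : k ≤ edges n d)
    (hX : (v < edges n d + 1 → X ≤ 11) ∧ X ≤ 32) (e : ℕ) :
    (wordExpr a b e).Ok W (loopState x n d out v k c X) := by
  unfold Fits at hW
  set N := edges n d + 1 with hN
  have hk1 : a * (k + 1) ≤ a * N := Nat.mul_le_mul_left a (by omega)
  rcases e with _ | _ | _ | _ | e
  · show 0 < W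
    omega
  · simp only [wordExpr, ok_times, ok_ifLt, ok_lit, ok_var, val_times, val_ifLt, val_lit, val_var,
      loopState_reg, ← hN]
    refine ⟨⟨⟨trivial, trivial, fun _ => by omega, fun _ => by omega⟩, trivial, ?_⟩, trivial, ?_⟩
    · split_ifs
      · have : a * 8 * N = 8 * (a * N) := by ring
        omega
      · have : a * 2 * N = 2 * (a * N) := by ring
        omega
    · split_ifs with h
      · have h1 : a * 8 * N * X ≤ a * 8 * N * 11 := Nat.mul_le_mul_left _ (hX.1 h)
        have h2 : a * 8 * N * 11 = 88 * (a * N) := by ring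
        omega
      · have h1 : a * 2 * N * X ≤ a * 2 * N * 32 := Nat.mul_le_mul_left _ hX.2
        have h2 : a * 2 * N * 32 = 64 * (a * N) := by ring
        omega
  · simp only [wordExpr, ok_ifLt, ok_lit, ok_var]
    exact ⟨trivial, trivial, fun _ => by omega, fun _ => by omega⟩
  · simp only [wordExpr, ok_times, ok_ifLt, ok_plus, ok_lit, ok_var, val_ifLt, val_plus, val_lit,
      val_var, loopState_reg, ← hN]
    refine ⟨⟨trivial, trivial, fun _ => by omega, fun _ => by omega⟩,
      ⟨trivial, by omega, by omega⟩, ?_⟩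
    split_ifs
    · have h1 : a * 4 * (k + 1) = 4 * (a * (k + 1)) := by ring
      omega
    · omega
  · simp only [wordExpr, ok_times, ok_lit, ok_var, val_lit, val_var, loopState_reg, ← hN]
    have h1 : b * 8 * N = 8 * (b * N) := by ring
    exact ⟨by omega, trivial, by omega⟩

theorem wordExpr_below (a b e : ℕ) : (wordExpr a b e).Below 20 ∧ (wordExpr a b e).width ≤ 79 := by
  rcases e with _ | _ | _ | _ | e <;>
    simp [wordExpr, times, ifLt, plus, Below, width]

theorem reaches_putWord {w a b : ℕ} {t : ℕ → ℕ} {α β : ℕ → ℕ → Bool} (hW : Fits a b n d (2 ^ w))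
    (hv : v < 2 * (edges n d + 1)) {e : ℕ} (he : e < 5)
    (ht : t (5 * v + (1 + e)) = vertexWord a b n d α β v e) :
    Reaches w (putWord a b e) ((wordExpr a b e).cost + 6)
      (Agrees (loopState x n d (upTo t (5 * v + (1 + e))) v (vertexIndex n d v) c
        (vertexLevel n d α β v)))
      (Agrees (loopState x n d (upTo t (5 * v + (1 + e) + 1)) v (vertexIndex n d v) c
        (vertexLevel n d α β v))) := by
  have hk : vertexIndex n d v ≤ edges n d := by unfold vertexIndex; split_ifs <;> omega
  have hok := ok_wordExpr (x := x) (out := upTo t (5 * v + (1 + e))) (c := c) hW hk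
    (vertexLevel_le (v := v) α β) e
  have hok' : (plus (times (lit 5) (var 6)) (lit (1 + e))).Ok (2 ^ w)
      (loopState x n d (upTo t (5 * v + (1 + e))) v (vertexIndex n d v) c
        (vertexLevel n d α β v)) := by
    unfold Fits at hW
    simp only [ok_plus, ok_times, ok_lit, ok_var, val_times, val_lit, val_var, loopState_reg]
    refine ⟨⟨?_, trivial, ?_⟩, ?_, ?_⟩ <;> omega
  have h := reaches_put (m := 1) hok' hok (by simp [plus, times, Below])
    (wordExpr_below a b e).1 (by simp [plus, times, width]) (wordExpr_below a b e).2
  rw [val_wordExpr, val_plus, val_times, val_lit, val_lit, val_var] at h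
  simp only [loopState_reg] at h
  rw [← ht, loopState_setMem, update_upTo] at h
  intro s hs
  obtain ⟨t', s', h1, h2, h3⟩ := h s hs
  refine ⟨t', s', h1, ?_, h3⟩
  have : (plus (times (lit 5) (var 6)) (lit (1 + e))).cost = 5 := rfl
  omega

/-- A bound for the running time of `body`. -/
def bodyCost (a b : ℕ) : ℕ :=
  indexExpr.cost + 1 + (levelExpr.cost + 1 + ((wordExpr a b 0).cost + 6 +
    ((wordExpr a b 1).cost + 6 + ((wordExpr a b 2).cost + 6 + ((wordExpr a b 3).cost + 6 +
    ((wordExpr a b 4).cost + 6 + ((plus (var 6) (lit 1)).cost + 1 +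
    ((ifLt (var 6) (times (lit 2) (var 4)) (lit 1) (lit 0)).cost + 1))))))))

theorem reaches_body {a b w : ℕ} {t : ℕ → ℕ} (hx : ∀ i, 2 ≤ i → x.getD i 0 ≤ 1) (hn : 1 ≤ n)
    (hW : Fits a b n d (2 ^ w)) (hv : v < 2 * (edges n d + 1))
    (ht : ∀ e < 5, t (5 * v + (1 + e)) =
      vertexWord a b n d (rowBits x d 2) (rowBits x d (2 + n * d)) v e) :
    Reaches w (body a b) (bodyCost a b)
      (Agrees (loopState x n d (upTo t (5 * v + 1)) v k 1 X))
      (Agrees (loopState x n d (upTo t (5 * (v + 1) + 1)) (v + 1) (vertexIndex n d v)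
        (if v + 1 < 2 * (edges n d + 1) then 1 else 0)
        (vertexLevel n d (rowBits x d 2) (rowBits x d (2 + n * d)) v))) := by
  have hk : vertexIndex n d v ≤ edges n d := by unfold vertexIndex; split_ifs <;> omega
  have hW' := hW
  unfold Fits at hW'
  have h7 := reaches_assign (w := w) (r := 7) (e := indexExpr)
    (σ := loopState x n d (upTo t (5 * v + 1)) v k 1 X)
    (by
      simp only [indexExpr, ok_ifLt, ok_minus, ok_var, val_var, loopState_reg]
      exact ⟨trivial, trivial, fun _ => trivial, fun _ => ⟨trivial, trivial, by omega, by omega⟩⟩)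
    (by simp [indexExpr, ifLt, minus, Below]) (by simp [indexExpr, ifLt, minus, width])
    (by norm_num)
  rw [show indexExpr.val (loopState x n d (upTo t (5 * v + 1)) v k 1 X) = vertexIndex n d v by
    simp only [indexExpr, val_ifLt, val_minus, val_var, loopState_reg, vertexIndex],
    loopState_setReg_seven] at h7
  have h9 := reaches_assign (w := w) (r := 9) (e := levelExpr)
    (σ := loopState x n d (upTo t (5 * v + 1)) v (vertexIndex n d v) 1 X)
    (ok_levelExpr hx hn hW hk)
    (by simp [levelExpr, hikerExpr, quarterExpr, dogExpr, waveExpr, bitExpr, ifLt, ifLe, ifEq,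
      minus, plus, times, quot, rem, Below])
    (by simp [levelExpr, hikerExpr, quarterExpr, dogExpr, waveExpr, bitExpr, ifLt, ifLe, ifEq,
      minus, plus, times, quot, rem, width]) (by norm_num)
  rw [val_levelExpr hx, loopState_setReg_nine] at h9
  have hput := fun e he => reaches_putWord (x := x) (c := 1) hW hv he (ht e he)
  have h6 := reaches_assign (w := w) (r := 6) (e := plus (var 6) (lit 1))
    (σ := loopState x n d (upTo t (5 * (v + 1) + 1)) v (vertexIndex n d v) 1
      (vertexLevel n d (rowBits x d 2) (rowBits x d (2 + n * d)) v))
    (by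
      simp only [ok_plus, ok_var, ok_lit, val_var, val_lit, loopState_reg]
      exact ⟨trivial, by omega, by omega⟩)
    (by simp [plus, Below]) (by simp [plus, width]) (by norm_num)
  rw [loopState_setReg_six] at h6
  have h8 := reaches_assign (w := w) (r := 8)
    (e := ifLt (var 6) (times (lit 2) (var 4)) (lit 1) (lit 0))
    (σ := loopState x n d (upTo t (5 * (v + 1) + 1)) (v + 1) (vertexIndex n d v) 1
      (vertexLevel n d (rowBits x d 2) (rowBits x d (2 + n * d)) v))
    (by
      simp only [ok_ifLt, ok_times, ok_var, ok_lit, val_var, val_lit, loopState_reg]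
      exact ⟨trivial, ⟨by omega, trivial, by omega⟩, fun _ => by omega, fun _ => by omega⟩)
    (by simp [ifLt, times, Below]) (by simp [ifLt, times, width]) (by norm_num)
  rw [val_ifLt, val_times, val_var, val_var, val_lit, val_lit, val_lit,
    loopState_setReg_eight] at h8
  simp only [loopState_reg] at h8
  exact h7.seq <| h9.seq <| (hput 0 (by norm_num)).seq <| (hput 1 (by norm_num)).seq <|
    (hput 2 (by norm_num)).seq <| (hput 3 (by norm_num)).seq <| (hput 4 (by norm_num)).seq <|
    h6.seq h8

/-- A bound for the running time of `setup`. -/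
def setupCost : ℕ := 100

theorem reaches_setup {w a b : ℕ} (hn : 1 ≤ n) (h0 : x.getD 0 0 = n) (h1 : x.getD 1 0 = d)
    (hW : Fits a b n d (2 ^ w)) {t : ℕ → ℕ} (ht : t 0 = edges n d + 1) :
    Reaches w setup setupCost (Agrees (init x)) (Agrees (loopState x n d (upTo t 1) 0 0 1 0)) := by
  have hs := size_bounds (d := d) hn
  have hW' := hW
  unfold Fits at hW'
  have hM : n * (4 * d + 20) ≤ edges n d := by unfold edges; omega
  have hK : climbTime n d = n * (4 * d + 20) + 6 + n * (4 * d + 2) := rfl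
  have a1 := reaches_assign (w := w) (r := 1) (e := fetch 0 (lit 0)) (σ := init x)
    (show 0 < 2 ^ w by omega) trivial (by simp [width]) (by norm_num)
  have v1 : (fetch 0 (lit 0)).val (init x) = n := h0
  rw [v1] at a1
  have a2 := reaches_assign (w := w) (r := 2) (e := fetch 0 (lit 1)) (σ := (init x).setReg 1 n)
    (show 1 < 2 ^ w by omega) trivial (by simp [width]) (by norm_num)
  have v2 : (fetch 0 (lit 1)).val ((init x).setReg 1 n) = d := h1
  rw [v2] at a2
  have a3 := reaches_assign (w := w) (r := 3)
    (e := times (var 1) (plus (times (lit 4) (var 2)) (lit 20)))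
    (σ := ((init x).setReg 1 n).setReg 2 d)
    (by
      show True ∧ (((4 < 2 ^ w ∧ True ∧ 4 * d < 2 ^ w) ∧ 20 < 2 ^ w ∧ 4 * d + 20 < 2 ^ w) ∧
        n * (4 * d + 20) < 2 ^ w)
      refine ⟨trivial, ⟨⟨?_, trivial, ?_⟩, ?_, ?_⟩, ?_⟩ <;> omega)
    (by simp [plus, times, Below]) (by simp [plus, times, width]) (by norm_num)
  have v3 : (times (var 1) (plus (times (lit 4) (var 2)) (lit 20))).val
    (((init x).setReg 1 n).setReg 2 d) = n * (4 * d + 20) := rfl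
  rw [v3] at a3
  have a4 := reaches_assign (w := w) (r := 4) (e := plus (times (lit 4) (var 3)) (lit 1))
    (σ := (((init x).setReg 1 n).setReg 2 d).setReg 3 (n * (4 * d + 20)))
    (by
      show (4 < 2 ^ w ∧ True ∧ 4 * (n * (4 * d + 20)) < 2 ^ w) ∧ 1 < 2 ^ w ∧
        4 * (n * (4 * d + 20)) + 1 < 2 ^ w
      have : edges n d = 4 * (n * (4 * d + 20)) := rfl
      refine ⟨⟨?_, trivial, ?_⟩, ?_, ?_⟩ <;> omega)
    (by simp [plus, times, Below]) (by simp [plus, times, width]) (by norm_num)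
  have v4 : (plus (times (lit 4) (var 3)) (lit 1)).val
    ((((init x).setReg 1 n).setReg 2 d).setReg 3 (n * (4 * d + 20))) = edges n d + 1 := rfl
  rw [v4] at a4
  have a5 := reaches_assign (w := w) (r := 5) (e := plus (plus (var 3) (lit 6))
      (times (var 1) (plus (times (lit 4) (var 2)) (lit 2))))
    (σ := ((((init x).setReg 1 n).setReg 2 d).setReg 3 (n * (4 * d + 20))).setReg 4
      (edges n d + 1))
    (by
      show (True ∧ 6 < 2 ^ w ∧ n * (4 * d + 20) + 6 < 2 ^ w) ∧
        (True ∧ ((4 < 2 ^ w ∧ True ∧ 4 * d < 2 ^ w) ∧ 2 < 2 ^ w ∧ 4 * d + 2 < 2 ^ w) ∧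
        n * (4 * d + 2) < 2 ^ w) ∧ n * (4 * d + 20) + 6 + n * (4 * d + 2) < 2 ^ w
      refine ⟨⟨trivial, ?_, ?_⟩, ⟨trivial, ⟨⟨?_, trivial, ?_⟩, ?_, ?_⟩, ?_⟩, ?_⟩ <;> omega)
    (by simp [plus, times, Below]) (by simp [plus, times, width]) (by norm_num)
  have v5 : (plus (plus (var 3) (lit 6)) (times (var 1) (plus (times (lit 4) (var 2)) (lit 2)))).val
    (((((init x).setReg 1 n).setReg 2 d).setReg 3 (n * (4 * d + 20))).setReg 4
      (edges n d + 1)) = climbTime n d := rfl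
  rw [v5] at a5
  have a8 := reaches_assign (w := w) (r := 8) (e := lit 1)
    (σ := (((((init x).setReg 1 n).setReg 2 d).setReg 3 (n * (4 * d + 20))).setReg 4
      (edges n d + 1)).setReg 5 (climbTime n d))
    (show 1 < 2 ^ w by omega) trivial (by simp [width]) (by norm_num)
  have e8 : ((((((init x).setReg 1 n).setReg 2 d).setReg 3 (n * (4 * d + 20))).setReg 4
      (edges n d + 1)).setReg 5 (climbTime n d)).setReg 8 ((lit 1).val
      ((((((init x).setReg 1 n).setReg 2 d).setReg 3 (n * (4 * d + 20))).setReg 4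
      (edges n d + 1)).setReg 5 (climbTime n d))) = loopState x n d (upTo t 0) 0 0 1 0 := by
    unfold loopState State.setReg init
    congr 1
    · funext q
      simp only [Function.update_apply, val_lit]
      split_ifs <;> first | rfl | omega
    · funext m i
      simp [upTo]
  rw [e8] at a8
  have p := reaches_put (w := w) (m := 1) (a := lit 0) (e := var 4)
    (σ := loopState x n d (upTo t 0) 0 0 1 0) (show 0 < 2 ^ w by omega) trivial trivial
    (by simp [Below]) (by simp [width]) (by simp [width])
  have vp : (var 4).val (loopState x n d (upTo t 0) 0 0 1 0) = t 0 := ht.symm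
  rw [vp, val_lit, loopState_setMem, update_upTo] at p
  intro s hs
  obtain ⟨t', s', r1, r2, r3⟩ := (a1.seq <| a2.seq <| a3.seq <| a4.seq <| a5.seq <| a8.seq p) s hs
  refine ⟨t', s', r1, r2.trans ?_, r3⟩
  simp [setupCost, cost, plus, times]

/-- The program of the reduction. -/
def reduction (a b : ℕ) : Prog := .seq setup (.loop 8 (body a b))

/-- The final condition has the form required by `Run.shift`: from register 100 and array 1 on, the
machine looks like a fresh one with input `y`. -/
theorem reaches_reduction {w a b : ℕ} (hx : ∀ i, 2 ≤ i → x.getD i 0 ≤ 1) (hn : 1 ≤ n)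
    (h0 : x.getD 0 0 = n) (h1 : x.getD 1 0 = d) (hW : Fits a b n d (2 ^ w)) {y : List ℕ}
    (hy : y.length = 5 * (2 * (edges n d + 1)) + 1) (hy0 : y.getD 0 0 = edges n d + 1)
    (hyv : ∀ v < 2 * (edges n d + 1), ∀ e < 5, y.getD (5 * v + (1 + e)) 0 =
      vertexWord a b n d (rowBits x d 2) (rowBits x d (2 + n * d)) v e) :
    Reaches w (reduction a b)
      (setupCost + (2 * (edges n d + 1) * (bodyCost a b + 1) + 1)) (Agrees (init x))
      fun s => (∀ r, s.reg (r + 100) = (init y).reg r) ∧ ∀ m, s.mem (m + 1) = (init y).mem m := by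
  set t : ℕ → ℕ := fun i => y.getD i 0 with ht
  have hset := reaches_setup (x := x) hn h0 h1 hW (t := t) hy0
  have hloop := Reaches.loop (w := w) (p := body a b) (C := bodyCost a b) (a := 8)
    (N := 2 * (edges n d + 1))
    -- Registers 7 and 9 hold leftovers from the previous vertex, so the invariant leaves them
    -- unspecified.
    (I := fun v s => ∃ k X, Agrees (loopState x n d (upTo t (5 * v + 1)) v k
      (if v < 2 * (edges n d + 1) then 1 else 0) X) s)
    (fun v hv s hs => by
      obtain ⟨k, X, hs⟩ := hs
      rw [if_pos hv] at hs
      obtain ⟨t', s', r1, r2, r3⟩ := reaches_body (t := t) hx hn hW hv (hyv v hv) s hs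
      exact ⟨t', s', r1, r2, _, _, r3⟩)
    (fun v hv s hs => by
      obtain ⟨k, X, hs⟩ := hs
      rw [if_pos hv] at hs
      rw [hs.1 8 (by norm_num), loopState_reg.2.2.2.2.2.2.2.1]
      norm_num)
    (fun s hs => by
      obtain ⟨k, X, hs⟩ := hs
      rw [if_neg (lt_irrefl _)] at hs
      rw [hs.1 8 (by norm_num), loopState_reg.2.2.2.2.2.2.2.1])
  intro s hs
  obtain ⟨t1, s1, r1, r2, r3⟩ := hset s hs
  obtain ⟨t2, s2, r4, r5, k, X, r6⟩ := hloop s1 ⟨0, 0, by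
    rw [if_pos (by omega)]; exact r3⟩
  refine ⟨_, s2, .seq r1 r4, by omega, fun r => ?_, fun m => ?_⟩
  · rw [r6.1 _ (by omega)]
    simp [loopState, init]
  · rw [r6.2]
    funext i
    simp only [loopState, init, upTo, ← hy, ht]
    rcases m with _ | m
    · simp only [zero_add, Nat.one_ne_zero, if_false, if_true]
      split_ifs with h
      · rfl
      · rw [List.getD_eq_default _ _ (by omega)]
    · simp

end

end BarkingReduction

/-! ### Instances -/

namespace BarkingReduction

open WordRAM

theorem getD_flatten {m c : ℕ} (hc : c < m) (L : List (List ℕ)) (hL : ∀ l ∈ L, l.length = m)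
    (i : ℕ) : L.flatten.getD (m * i + c) 0 = (L.getD i []).getD c 0 := by
  induction L generalizing i with
  | nil => simp
  | cons l L ih =>
    have hl : l.length = m := hL l (by simp)
    rw [List.flatten_cons]
    rcases i with _ | i
    · rw [mul_zero, zero_add, List.getD_append _ _ _ _ (by omega)]
      rfl
    · rw [List.getD_append_right _ _ _ _ (by rw [hl, mul_add]; omega), hl,
        show m * (i + 1) + c - m = m * i + c by rw [mul_add]; omega,
        ih (fun l hl => hL l (by simp [hl]))]
      rfl

theorem getD_ofFn_append {n m i : ℕ} (f : Fin n → List ℕ) (g : Fin m → List ℕ) (hi : i < n) :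
    (List.ofFn f ++ List.ofFn g).getD i [] = f ⟨i, hi⟩ := by
  rw [List.getD_append _ _ _ _ (by simpa using hi), List.getD_eq_getElem _ _ (by simpa using hi)]
  simp

theorem getD_ofFn_append_right {n m i : ℕ} (f : Fin n → List ℕ) (g : Fin m → List ℕ)
    (hi : i < m) : (List.ofFn f ++ List.ofFn g).getD (n + i) [] = g ⟨i, hi⟩ := by
  rw [List.getD_append_right _ _ _ _ (by simp), List.getD_eq_getElem _ _ (by simpa using hi)]
  simp

/-! ### The word list of a family of vectors -/

section vectors

variable {D : ℕ → ℕ} (I : OVInstance D)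

theorem words_tail : (orthogonalVectors D).words I = I.n :: D I.n ::
    ((List.ofFn fun i => List.ofFn fun j => (I.A i j).toNat) ++
      (List.ofFn fun i => List.ofFn fun j => (I.B i j).toNat)).flatten := by
  rw [List.flatten_append]; rfl

theorem length_words : ((orthogonalVectors D).words I).length = 2 * (I.n * D I.n) + 2 := by
  rw [words_tail]
  simp [List.length_flatten, List.map_ofFn, Function.comp_def]
  ring

theorem words_le_one (i : ℕ) (hi : 2 ≤ i) : ((orthogonalVectors D).words I).getD i 0 ≤ 1 := by
  obtain ⟨k, rfl⟩ := Nat.exists_eq_add_of_le' hi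
  rw [words_tail]
  simp only [List.getD_cons_succ]
  set L := (List.ofFn fun i => List.ofFn fun j => (I.A i j).toNat) ++
      (List.ofFn fun i => List.ofFn fun j => (I.B i j).toNat) with hL
  have h : ∀ a ∈ L.flatten, a ≤ 1 := by
    intro a ha
    obtain ⟨l, hl, hal⟩ := List.mem_flatten.1 ha
    rw [hL, List.mem_append] at hl
    rcases hl with hl | hl <;> obtain ⟨r, rfl⟩ := List.mem_ofFn.1 hl <;>
      obtain ⟨e, rfl⟩ := List.mem_ofFn.1 hal <;> exact Bool.toNat_le _
  rcases Nat.lt_or_ge k L.flatten.length with hk | hk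
  · rw [List.getD_eq_getElem _ _ hk]
    exact h _ (List.getElem_mem hk)
  · rw [List.getD_eq_default _ _ hk]
    exact Nat.zero_le _

theorem length_rows (l : List ℕ)
    (hl : l ∈ (List.ofFn fun i => List.ofFn fun j => (I.A i j).toNat) ++
      (List.ofFn fun i => List.ofFn fun j => (I.B i j).toNat)) : l.length = D I.n := by
  rw [List.mem_append] at hl
  rcases hl with hl | hl <;> obtain ⟨r, rfl⟩ := List.mem_ofFn.1 hl <;> simp

theorem rowBits_A (i : Fin I.n) (k : Fin (D I.n)) :
    rowBits ((orthogonalVectors D).words I) (D I.n) 2 i k = I.A i k := by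
  unfold rowBits
  rw [words_tail, show 2 + ((i : ℕ) * D I.n + k) = D I.n * i + k + 1 + 1 by ring]
  simp only [List.getD_cons_succ]
  rw [getD_flatten k.2 _ (length_rows I), getD_ofFn_append _ _ i.2,
    List.getD_eq_getElem _ _ (by simp)]
  cases h : I.A i k <;> simp [h]

theorem rowBits_B (i : Fin I.n) (k : Fin (D I.n)) :
    rowBits ((orthogonalVectors D).words I) (D I.n) (2 + I.n * D I.n) i k = I.B i k := by
  unfold rowBits
  rw [words_tail, show 2 + I.n * D I.n + ((i : ℕ) * D I.n + k) =
    D I.n * (I.n + i) + k + 1 + 1 by ring]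
  simp only [List.getD_cons_succ]
  rw [getD_flatten k.2 _ (length_rows I), getD_ofFn_append_right _ _ i.2,
    List.getD_eq_getElem _ _ (by simp)]
  cases h : I.B i k <;> simp [h]

/-- The first family of vectors of an instance, as read by the machine. -/
def rowsA : ℕ → ℕ → Bool := rowBits ((orthogonalVectors D).words I) (D I.n) 2

/-- The second family of vectors of an instance, as read by the machine. -/
def rowsB : ℕ → ℕ → Bool :=
  rowBits ((orthogonalVectors D).words I) (D I.n) (2 + I.n * D I.n)

theorem hasOrthogonalPair_iff :
    HasOrthogonalPair I.n (D I.n) (rowsA I) (rowsB I) ↔ (orthogonalVectors D).Yes I := by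
  have key : ∀ i j : Fin I.n, ∑ k, (I.A i k).toNat * (I.B j k).toNat = 0 ↔
      ∀ k, I.A i k = false ∨ I.B j k = false := fun i j => by
    simp
  constructor
  · rintro ⟨i, hi, j, hj, h⟩
    refine ⟨⟨i, hi⟩, ⟨j, hj⟩, (key _ _).2 fun k => ?_⟩
    have := h k k.2
    rwa [rowsA, rowsB, rowBits_A I ⟨i, hi⟩ k, rowBits_B I ⟨j, hj⟩ k] at this
  · rintro ⟨i, j, h⟩
    refine ⟨i, i.2, j, j.2, fun c hc => ?_⟩
    have := (key i j).1 h ⟨c, hc⟩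
    rwa [← rowBits_A, ← rowBits_B] at this

end vectors

/-! ### The barking instance built from two families -/

section barking

variable {a b : ℕ} (ha : 0 < a) (hb : 0 < b) {κ : ℕ}

/-- As `N ≥ 2`, the constant factor is absorbed by a fixed power of `N`; the exponent depends only
on `a` and `b`, hence only on `ρ`. -/
theorem bounded_of_le {N κ z : ℕ} (hN : 2 ≤ N) (hκ : 100 * (a + b) ≤ 2 ^ κ)
    (h : z ≤ 100 * (a * N) + 100 * (b * N)) : z ≤ N ^ (κ + 1) := by
  calc z ≤ 100 * (a + b) * N := h.trans_eq (by ring)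
    _ ≤ N ^ κ * N := Nat.mul_le_mul_right _ (hκ.trans (Nat.pow_le_pow_left hN κ))
    _ = N ^ (κ + 1) := (pow_succ _ _).symm

/-- The instance of the barking problem constructed from two families of vectors. -/
noncomputable def barkingInstance (hκ : 100 * (a + b) ≤ 2 ^ κ) {n d : ℕ} (hn : 1 ≤ n)
    (α β : ℕ → ℕ → Bool) : BarkingInstance (κ + 1) where
  n := edges n d + 1
  two_le := by have := edges_pos (d := d) hn; omega
  P := fun k => hikerPoint a b hb n d α k
  Q := fun k => dogPoint a b hb n d β k
  bounded_P := fun k => by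
    have h2 : 2 ≤ edges n d + 1 := by have := edges_pos (d := d) hn; omega
    have h3 : a * ((k : ℕ) + 1) ≤ a * (edges n d + 1) := Nat.mul_le_mul_left a k.2
    refine ⟨bounded_of_le h2 hκ ?_, bounded_of_le h2 hκ ?_, bounded_of_le h2 hκ ?_⟩
    · have h4 : a * 8 * (edges n d + 1) * hikerLevel n d α k ≤ a * 8 * (edges n d + 1) * 11 :=
        Nat.mul_le_mul_left _ (hikerLevel_le n d α k)
      have h5 : a * 8 * (edges n d + 1) * 11 = 88 * (a * (edges n d + 1)) := by ring
      simp only [hikerPoint, Int.natAbs_natCast]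
      omega
    · have h5 : a * 4 * ((k : ℕ) + 1) = 4 * (a * ((k : ℕ) + 1)) := by ring
      simp only [hikerPoint, Int.natAbs_natCast]
      omega
    · have h5 : b * 8 * (edges n d + 1) = 8 * (b * (edges n d + 1)) := by ring
      simp only [hikerPoint]
      omega
  bounded_Q := fun k => by
    have h2 : 2 ≤ edges n d + 1 := by have := edges_pos (d := d) hn; omega
    have h3 : a * ((k : ℕ) + 1) ≤ a * (edges n d + 1) := Nat.mul_le_mul_left a k.2
    refine ⟨bounded_of_le h2 hκ ?_, bounded_of_le h2 hκ ?_, bounded_of_le h2 hκ ?_⟩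
    · have h4 : a * 2 * (edges n d + 1) * (dogQuarter d β k + 12) ≤
          a * 2 * (edges n d + 1) * 32 :=
        Nat.mul_le_mul_left _ (by have := dogQuarter_le (d := d) β k; omega)
      have h5 : a * 2 * (edges n d + 1) * 32 = 64 * (a * (edges n d + 1)) := by ring
      simp only [dogPoint, Int.natAbs_natCast]
      omega
    · simp only [dogPoint, Int.natAbs_neg, Int.natAbs_natCast]
      omega
    · have h5 : b * 8 * (edges n d + 1) = 8 * (b * (edges n d + 1)) := by ring
      simp only [dogPoint]
      omega
  simple_P := isSimple_hikerLine hb α ha hn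
  simple_Q := isSimple_dogLine hb β ha hn
  disjoint := disjoint_carrier hb α β ha hn

variable (hκ : 100 * (a + b) ≤ 2 ^ κ) {n d : ℕ} (hn : 1 ≤ n) (α β : ℕ → ℕ → Bool)

theorem barkingInstance_yes_iff {ρ : ℝ} (hd : 2 ≤ d) (h1 : 13 / 4 * (a / b) ≤ ρ)
    (h2 : ρ < 7 / 2 * (a / b)) :
    (barkingDecision ρ (κ + 1)).Yes (barkingInstance ha hb hκ (d := d) hn α β) ↔
      HasOrthogonalPair n d α β :=
  ⟨fun h => hasOrthogonalPair_of_barkingDistance hb α β ha hn hd h2 h,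
    fun h => barkingDistance_of_hasOrthogonalPair hb α β ha hn h1 h⟩

theorem barkingInstance_words (ρ : ℝ) :
    (barkingDecision ρ (κ + 1)).words (barkingInstance ha hb hκ (d := d) hn α β) =
      (edges n d + 1) ::
        ((List.ofFn fun k : Fin (edges n d + 1) => (hikerPoint a b hb n d α k).words) ++
          (List.ofFn fun k : Fin (edges n d + 1) => (dogPoint a b hb n d β k).words)).flatten := by
  rw [List.flatten_append]; rfl

theorem length_barkingInstance_words (ρ : ℝ) :
    ((barkingDecision ρ (κ + 1)).words (barkingInstance ha hb hκ (d := d) hn α β)).length =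
      5 * (2 * (edges n d + 1)) + 1 := by
  rw [barkingInstance_words]
  simp [List.length_flatten, List.map_ofFn, Function.comp_def, RatPoint.words]
  ring

theorem hikerPoint_words (k : ℕ) : (hikerPoint a b hb n d α k).words =
    [0, a * 8 * (edges n d + 1) * hikerLevel n d α k, 0, a * 4 * (k + 1),
      b * 8 * (edges n d + 1)] := by
  simp only [RatPoint.words, hikerPoint, Int.natAbs_natCast, not_lt.2 (Int.natCast_nonneg _),
    if_false]

theorem dogPoint_words (ha : 0 < a) (i : ℕ) : (dogPoint a b hb n d β i).words =
    [0, a * 2 * (edges n d + 1) * (dogQuarter d β i + 12), 1, a * (i + 1),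
      b * 8 * (edges n d + 1)] := by
  have h : -((a * (i + 1) : ℕ) : ℤ) < 0 := by
    have : 0 < a * (i + 1) := by positivity
    omega
  simp only [RatPoint.words, dogPoint, Int.natAbs_natCast, Int.natAbs_neg,
    not_lt.2 (Int.natCast_nonneg _), h, if_false, if_true]

theorem barkingInstance_vertexWord (ρ : ℝ) {v : ℕ} (hv : v < 2 * (edges n d + 1)) {e : ℕ}
    (he : e < 5) :
    ((barkingDecision ρ (κ + 1)).words
      (barkingInstance ha hb hκ (d := d) hn α β)).getD (5 * v + (1 + e)) 0 =
      vertexWord a b n d α β v e := by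
  rw [barkingInstance_words, show 5 * v + (1 + e) = 5 * v + e + 1 by ring, List.getD_cons_succ,
    getD_flatten he]
  · rcases Nat.lt_or_ge v (edges n d + 1) with h | h
    · rw [getD_ofFn_append _ _ h]
      rw [hikerPoint_words]
      interval_cases e <;> simp [vertexWord, h]
    · obtain ⟨i, rfl⟩ := Nat.exists_eq_add_of_le h
      rw [getD_ofFn_append_right _ _ (by omega)]
      rw [dogPoint_words hb β ha]
      have h' : ¬ edges n d + 1 + i < edges n d + 1 := by omega
      interval_cases e <;> simp only [vertexWord, h', if_false, Nat.add_sub_cancel_left] <;> rfl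
  · intro l hl
    rw [List.mem_append] at hl
    rcases hl with hl | hl <;> obtain ⟨r, rfl⟩ := List.mem_ofFn.1 hl <;> rfl

end barking

/-! ### Running times -/

theorem size_le {n d L : ℕ} (hn : 1 ≤ n) (hd : 2 ≤ d) (hL : L = 2 * (n * d) + 4) :
    edges n d + 1 ≤ 28 * L ∧ edges n d + 1 ≤ 57 * (n * d) ∧ 8 ≤ L := by
  have h1 : n * 2 ≤ n * d := Nat.mul_le_mul_left n hd
  have h2 : edges n d = 16 * (n * d) + 80 * n := by unfold edges; ring
  omega

/-- A power of `L` with exponent `C` exceeds `C`, so a large exponent in the word-size condition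
turns constant factors into polynomial ones. -/
theorem fits_of_pow_le {a b n d L w e : ℕ} (hn : 1 ≤ n) (hd : 2 ≤ d)
    (hL : L = 2 * (n * d) + 4) (he : 10000 * (a + b + 1) + 1 ≤ e) (h : L ^ e ≤ 2 ^ w) :
    Fits a b n d (2 ^ w) := by
  obtain ⟨h1, -, h3⟩ := size_le hn hd hL
  refine lt_of_lt_of_le ?_ h
  have h5 : 10000 * (a + b + 1) < L ^ (10000 * (a + b + 1)) :=
    Nat.lt_pow_self (by omega)
  have h6 : 10000 * (a + b + 1) * L < L ^ e :=
    calc 10000 * (a + b + 1) * L < L ^ (10000 * (a + b + 1)) * L :=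
          Nat.mul_lt_mul_of_pos_right h5 (by omega)
      _ = L ^ (10000 * (a + b + 1) + 1) := (pow_succ _ _).symm
      _ ≤ L ^ e := Nat.pow_le_pow_right (by omega) he
  refine lt_of_le_of_lt ?_ h6
  have h7 : a * (edges n d + 1) ≤ a * (28 * L) := Nat.mul_le_mul_left _ h1
  have h8 : b * (edges n d + 1) ≤ b * (28 * L) := Nat.mul_le_mul_left _ h1
  have h9 : a * 1 ≤ a * L := Nat.mul_le_mul_left _ (by omega)
  have h10 : b * 1 ≤ b * L := Nat.mul_le_mul_left _ (by omega)
  have e1 : a * (28 * L) = 28 * (a * L) := by ring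
  have e2 : b * (28 * L) = 28 * (b * L) := by ring
  have e3 : 10000 * (a + b + 1) * L = 10000 * (a * L) + 10000 * (b * L) + 10000 * L := by ring
  omega

/-- The dimension used in the reduction. -/
noncomputable def dimension (δ : ℝ) (n : ℕ) : ℕ := ⌈(n : ℝ) ^ δ⌉₊ + 2

/-- OVC covers every superlogarithmic dimension; a small power of `n` is convenient as it inflates
the instance only by that power. The added 2 in `dimension` ensures `2 ≤ d`. -/
theorem isLittleO_dimension {δ : ℝ} (hδ : 0 < δ) :
    (fun n : ℕ => Real.log n) =o[Filter.atTop] fun n : ℕ => (dimension δ n : ℝ) := by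
  refine ((isLittleO_log_rpow_atTop hδ).comp_tendsto tendsto_natCast_atTop_atTop).trans_le ?_
  intro n
  have h0 : (0 : ℝ) ≤ (n : ℝ) ^ δ := by positivity
  have h1 := Nat.le_ceil ((n : ℝ) ^ δ)
  simp only [Function.comp, Real.norm_eq_abs, Nat.abs_cast, abs_of_nonneg h0, dimension]
  push_cast
  linarith

theorem size_le_rpow {n : ℕ} (hn : 1 ≤ n) {δ : ℝ} (hδ : 0 < δ) :
    ((edges n (dimension δ n) + 1 : ℕ) : ℝ) ≤ 240 * (n : ℝ) ^ (1 + δ) := by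
  have hn' : (1 : ℝ) ≤ n := by exact_mod_cast hn
  have h1 := (size_le (d := dimension δ n) hn (by unfold dimension; omega) rfl).2.1
  have h2 : ((edges n (dimension δ n) + 1 : ℕ) : ℝ) ≤ 57 * (n * dimension δ n) := by
    exact_mod_cast h1
  have h3 : (dimension δ n : ℝ) ≤ 4 * (n : ℝ) ^ δ := by
    have h4 := (Nat.ceil_lt_add_one (show (0 : ℝ) ≤ (n : ℝ) ^ δ by positivity)).le
    have h5 := Real.one_le_rpow hn' hδ.le
    unfold dimension
    push_cast
    linarith
  rw [Real.rpow_add (by positivity), Real.rpow_one]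
  have h6 : (n : ℝ) * dimension δ n ≤ n * (4 * (n : ℝ) ^ δ) :=
    mul_le_mul_of_nonneg_left h3 (by positivity)
  have h7 : 0 ≤ (n : ℝ) * (n : ℝ) ^ δ := by positivity
  linarith

/-- The total running time is subquadratic if that of the given program is. -/
theorem time_bound {n N K t : ℕ} (hn : 1 ≤ n) (hN1 : 1 ≤ N) {ε ε' C : ℝ} (hε : 0 < ε)
    (hε1 : ε ≤ 1) (hεε' : ε ≤ ε') (hN : (N : ℝ) ≤ 240 * (n : ℝ) ^ (1 + ε / 8))
    (ht : (t : ℝ) ≤ C * (N : ℝ) ^ (2 - ε')) :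
    ((K + 2 * N * K + t : ℕ) : ℝ) ≤
      (K + 480 * K + |C| * 240 ^ 2) * (n : ℝ) ^ (2 - ε / 2) := by
  have hn' : (1 : ℝ) ≤ n := by exact_mod_cast hn
  have hN' : (1 : ℝ) ≤ N := by exact_mod_cast hN1
  set A := (n : ℝ) ^ (2 - ε / 2) with hA
  have h1 : 1 ≤ A := Real.one_le_rpow hn' (by linarith)
  have h2 : (n : ℝ) ^ (1 + ε / 8) ≤ A := Real.rpow_le_rpow_of_exponent_le hn' (by linarith)
  have h3 : (N : ℝ) ^ (2 - ε') ≤ 240 ^ 2 * A :=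
    calc (N : ℝ) ^ (2 - ε') ≤ (N : ℝ) ^ (2 - ε) :=
          Real.rpow_le_rpow_of_exponent_le hN' (by linarith)
      _ ≤ (240 * (n : ℝ) ^ (1 + ε / 8)) ^ (2 - ε) :=
          Real.rpow_le_rpow (by positivity) hN (by linarith)
      _ = 240 ^ (2 - ε) * (n : ℝ) ^ ((1 + ε / 8) * (2 - ε)) := by
          rw [Real.mul_rpow (by norm_num) (by positivity), ← Real.rpow_mul (by positivity)]
      _ ≤ 240 ^ (2 : ℝ) * A := by
          refine mul_le_mul (Real.rpow_le_rpow_of_exponent_le (by norm_num) (by linarith))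
            -- The exponent `(1 + ε/8) * (2 - ε)` equals `2 - 3/4 * ε - ε ^ 2 / 8`, which is at most
            -- `2 - ε/2`.
            (Real.rpow_le_rpow_of_exponent_le hn' (by nlinarith)) (by positivity) (by positivity)
      _ = 240 ^ 2 * A := by norm_num
  have h4 : (t : ℝ) ≤ |C| * (240 ^ 2 * A) :=
    ht.trans ((mul_le_mul_of_nonneg_right (le_abs_self C) (by positivity)).trans
      (mul_le_mul_of_nonneg_left h3 (abs_nonneg C)))
  have hK : (0 : ℝ) ≤ K := K.cast_nonneg
  have h5 : (K : ℝ) * 1 ≤ K * A := mul_le_mul_of_nonneg_left h1 hK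
  have h6 : (K : ℝ) * N ≤ K * (240 * A) :=
    mul_le_mul_of_nonneg_left (hN.trans (by linarith)) hK
  push_cast
  linarith

/-- Coordinates must be rational while `ρ` is real, so the unit is a rational between `ρ / (7/2)`
and `ρ / (13/4)`. -/
theorem exists_scale {ρ : ℝ} (hρ : 0 < ρ) : ∃ a b : ℕ, 0 < a ∧ 0 < b ∧
    13 / 4 * ((a : ℝ) / b) ≤ ρ ∧ ρ < 7 / 2 * ((a : ℝ) / b) := by
  obtain ⟨q, h1, h2⟩ := exists_rat_btwn (show ρ / (7 / 2) < ρ / (13 / 4) by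
    rw [div_lt_div_iff₀ (by norm_num) (by norm_num)]; linarith)
  have hq : (0 : ℝ) < q := lt_trans (by positivity) h1
  have hq' : 0 < q := by exact_mod_cast hq
  have hnum := Rat.num_pos.2 hq'
  have e : (q : ℝ) = (q.num.toNat : ℝ) / q.den := by
    have h3 : ((q.num.toNat : ℤ) : ℝ) = q.num := by rw [Int.toNat_of_nonneg hnum.le]
    rw [Rat.cast_def, ← h3, Int.cast_natCast]
  refine ⟨q.num.toNat, q.den, by omega, q.den_pos, ?_, ?_⟩ <;> rw [← e]
  · rw [lt_div_iff₀ (by norm_num)] at h2; linarith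
  · rw [div_lt_iff₀ (by norm_num)] at h1; linarith

end BarkingReduction

open BarkingReduction WordRAM in
theorem mainTheorem4 (hOVC : OrthogonalVectorsConjecture) (ρ : ℝ) (hρ : 0 < ρ) :
    ∃ κ : ℕ, ∀ ε : ℝ, 0 < ε →
      ¬ (barkingDecision ρ κ).SolvableInTime fun n => (n : ℝ) ^ (2 - ε) := by
  obtain ⟨a, b, ha, hb, hρ1, hρ2⟩ := exists_scale hρ
  have hκ : 100 * (a + b) ≤ 2 ^ (100 * (a + b)) := Nat.lt_two_pow_self.le
  refine ⟨100 * (a + b) + 1, fun ε hε => ?_⟩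
  rintro ⟨p, c, C, hp⟩
  have hε1 : 0 < min ε 1 := lt_min hε one_pos
  refine hOVC (dimension (min ε 1 / 8)) (isLittleO_dimension (by positivity)) (min ε 1 / 2)
    (by positivity) ?_
  set D := dimension (min ε 1 / 8) with hD
  set K := 2 * bodyCost a b + 200 with hK
  refine ⟨.seq (reduction a b) (.seq (p.shift 100) (.op .or 0 100 100)),
    4 * c + 10000 * (a + b + 1) + 1, K + 480 * K + |C| * 240 ^ 2, fun (I : OVInstance D) w hw => ?_⟩
  have hd : 2 ≤ D I.n := Nat.le_add_left 2 _
  have hn := I.one_le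
  set x := (orthogonalVectors D).words I with hx
  set J := barkingInstance ha hb hκ (d := D I.n) hn (rowsA I) (rowsB I) with hJ
  have hlen : x.length + 2 = 2 * (I.n * D I.n) + 4 := by rw [hx, length_words I]
  have hsize := size_le hn hd hlen
  have hfits : Fits a b I.n (D I.n) (2 ^ w) := fits_of_pow_le hn hd hlen (by omega) hw
  have hlen' := length_barkingInstance_words ha hb hκ (d := D I.n) hn (rowsA I) (rowsB I) ρ
  rw [← hJ] at hlen'
  -- The given program needs words for the longer constructed input, whose length plus two is at
  -- most the fourth power of that of the original; this accounts for the `4 * c` in the exponent.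
  obtain ⟨t, s, hrun, ht, hs⟩ := hp J w (by
    refine le_trans ?_ hw
    calc (((barkingDecision ρ (100 * (a + b) + 1)).words J).length + 2) ^ c
        ≤ ((x.length + 2) ^ 4) ^ c := by
          refine Nat.pow_le_pow_left ?_ c
          have h1 : 8 ^ 3 * (x.length + 2) ≤ (x.length + 2) ^ 3 * (x.length + 2) :=
            Nat.mul_le_mul_right _ (Nat.pow_le_pow_left hsize.2.2 3)
          rw [hlen', pow_succ _ 3]
          omega
      _ = (x.length + 2) ^ (4 * c) := (pow_mul _ _ _).symm
      _ ≤ _ := Nat.pow_le_pow_right (by omega) (by omega))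
  obtain ⟨t₀, s₀, hrun₀, ht₀, hreg, hmem⟩ := reaches_reduction (w := w) (x := x) (d := D I.n)
    (words_le_one I) hn rfl rfl hfits hlen' rfl
    (fun v hv e he => barkingInstance_vertexWord ha hb hκ hn _ _ ρ hv he) (init x)
    ⟨fun _ _ => rfl, rfl⟩
  obtain ⟨s₁, hrun₁, hreg₁, -⟩ := hrun.shift hreg hmem
  refine ⟨_, _, .seq hrun₀ (.seq hrun₁ (.op .or 0 100 100 s₁)), ?_, ?_⟩
  · refine le_trans ?_ (time_bound (K := K) (t := t) hn (Nat.le_add_left 1 (edges I.n (D I.n)))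
      hε1 (min_le_right ε 1) (min_le_left ε 1) (size_le_rpow hn (by positivity)) ht)
    have h1 : 2 * (edges I.n (D I.n) + 1) * (bodyCost a b + 1) ≤
        2 * (edges I.n (D I.n) + 1) * K := Nat.mul_le_mul_left _ (by omega)
    have h2 : t₀ + (t + 1) ≤ K + 2 * (edges I.n (D I.n) + 1) * K + t := by
      unfold setupCost at ht₀
      omega
    exact_mod_cast h2
  · have h0 : s₁.reg 100 = s.reg 0 := hreg₁ 0
    simp only [State.setReg, Function.update_self, BinOp.eval, Nat.or_self, h0]
    rw [hs, hJ, barkingInstance_yes_iff ha hb hκ hn _ _ hd hρ1 hρ2]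
    exact hasOrthogonalPair_iff I
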